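/- Let $\lambda\in\mathbb{R}$. Let $\mathcal{S}_c$ be the space of Schwartz functions $f:\mathbb{R}^2\to\mathbb{C}$ with $\operatorname{supp} f\subseteq K\times\mathbb{R}$ for some compact $K\subset\mathbb{R}$, and let $\mathcal{A}=\mathcal{F}(\mathcal{S}_c)$, where $\mathcal{F}$ is the Fourier transform on $\mathbb{R}^2$. Every $f\in\mathcal{A}$ is a Schwartz function which, for each fixed $x_1$, extends to an entire function of $x_0$. Put $(\mathcal{F}_0f)(p_0,x_1)=\int e^{-ip_0y_0}f(y_0,x_1)\,dy_0$ and, for $f,g\in\mathcal{A}$, $$(f\star g)(x)=\int e^{ip_0x_0}(\mathcal{F}_0f)(p_0,x_1)\,g(x_0,e^{-\lambda p_0}x_1)\,\frac{dp_0}{2\pi},\qquad f^*(x)=\int e^{ip_0x_0}(\mathcal{F}_0\overline{f})(p_0,e^{-\lambda p_0}x_1)\,\frac{dp_0}{2\pi},\qquad \omega(f)=\int_{\mathbb{R}^2} f(x)\,d^2x .$$ The form $(f,g)=\omega(f^*\star g)$ is a positive definite inner product on $\mathcal{A}$; let $\mathcal{H}$ be the Hilbert space completion of $\mathcal{A}$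 in the induced norm, so that $\mathcal{A}$ is a dense subspace of $\mathcal{H}$. Let $\mathcal{T}_\kappa=\mathbb{C}[P_0,P_1,\mathcal{E},\mathcal{E}^{-1}]$ be the extended momentum algebra, that is, the commutative unital algebra generated by $P_0$, $P_1$ and an invertible element $\mathcal{E}$, with the antilinear involution determined by $P_\mu^*=P_\mu$ and $\mathcal{E}^*=\mathcal{E}$. Let $\rho:\mathcal{T}_\kappa\to\operatorname{End}(\mathcal{A})$ be the algebra homomorphism with $$(\rho(P_\mu)f)(x)=-i(\partial_\mu f)(x)\quad(\mu=0,1),\qquad(\rho(\mathcal{E})f)(x)=f(x_0+i\lambda,x_1).$$ Then the operators $\rho(P_0)$, $\rho(P_1)$ and $\rho(\mathcal{E})$, with domain $\mathcal{A}$, are essentially self-adjoint on $\mathcal{H}$. Moreover $\rho$ is an unbounded $*$-representation of $\mathcal{T}_\kappa$ on $\mathcal{A}$: the subspace $\mathcal{A}$ is dense in $\mathcal{H}$, and $(\rho(h)\psi,\phi)=(\psi,\rho(h^*)\phi)$ for all $h\in\mathcal{T}_\kappa$ and $\psi,\phi\in\mathcal{A}$. -/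

import Mathlib

open MeasureTheory
open scoped SchwartzMap FourierTransform LineDeriv ComplexConjugate

noncomputable section

namespace KappaMinkowski

/-- The plane `ℝ²` with coordinates `x 0`, `x 1`. -/
abbrev Plane : Type := EuclideanSpace ℝ (Fin 2)

/-- Fourier transform in the first variable,
`(F₀ f)(p₀, x₁) = ∫ exp (-i p₀ y₀) f (y₀, x₁) dy₀`. -/
def fourier0 (f : Plane → ℂ) (p₀ x₁ : ℝ) : ℂ :=
  ∫ y₀ : ℝ, Complex.exp (-(Complex.I * p₀ * y₀)) * f !₂[y₀, x₁]

/-- The star product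
`(f ⋆ g)(x) = ∫ exp (i p₀ x₀) (F₀ f)(p₀, x₁) g (x₀, exp (-lam p₀) x₁) dp₀ / 2π`. -/
def starProd (lam : ℝ) (f g : Plane → ℂ) (x : Plane) : ℂ :=
  (2 * Real.pi : ℂ)⁻¹ * ∫ p₀ : ℝ, Complex.exp (Complex.I * p₀ * x 0) *
    fourier0 f p₀ (x 1) * g !₂[x 0, Real.exp (-(lam * p₀)) * x 1]

/-- The involution
`f^*(x) = ∫ exp (i p₀ x₀) (F₀ (conj f))(p₀, exp (-lam p₀) x₁) dp₀ / 2π`. -/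
def starInv (lam : ℝ) (f : Plane → ℂ) (x : Plane) : ℂ :=
  (2 * Real.pi : ℂ)⁻¹ * ∫ p₀ : ℝ, Complex.exp (Complex.I * p₀ * x 0) *
    fourier0 (fun y => conj (f y)) p₀ (Real.exp (-(lam * p₀)) * x 1)

/-- The weight `ω(f) = ∫ f(x) d²x`. -/
def weight (f : Plane → ℂ) : ℂ := ∫ x : Plane, f x

/-- The GNS form `(f, g) = ω(f^* ⋆ g)`. -/
def gnsForm (lam : ℝ) (f g : Plane → ℂ) : ℂ := weight (starProd lam (starInv lam f) g)

/-- `S_c`: Schwartz functions on the plane with support in `K × ℝ` for some compact `K ⊆ ℝ`. -/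
def schwartzC : Submodule ℂ 𝓢(Plane, ℂ) where
  carrier := {f | ∃ K : Set ℝ, IsCompact K ∧ Function.support f ⊆ {x | x 0 ∈ K}}
  zero_mem' := ⟨∅, isCompact_empty, fun x hx => by simp at hx⟩
  add_mem' := by
    rintro f g ⟨K, hK, hf⟩ ⟨L, hL, hg⟩
    refine ⟨K ∪ L, hK.union hL, fun x hx => ?_⟩
    by_contra h
    have h1 : f x = 0 := by
      by_contra h'
      exact h (Or.inl (hf h'))
    have h2 : g x = 0 := by
      by_contra h'
      exact h (Or.inr (hg h'))
    exact hx (by simp [h1, h2])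
  smul_mem' := by
    rintro c f ⟨K, hK, hf⟩
    refine ⟨K, hK, fun x hx => hf fun h => hx (by simp [h])⟩

/-- The space `𝒜 = F(S_c)`. Mathlib's Fourier transform uses the kernel `exp (-2πi p·x)`; any other
normalization gives the same space, as `S_c` is stable under dilations and scalar multiples. -/
def algA : Submodule ℂ 𝓢(Plane, ℂ) :=
  schwartzC.map (FourierTransform.fourierEquiv ℂ 𝓢(Plane, ℂ)).toLinearMap

/-! ### Slices of Schwartz functions -/

theorem schwartz_bound (f : 𝓢(Plane, ℂ)) : ∃ C : ℝ, 0 < C ∧ ∀ a b : ℝ,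
    ‖f !₂[a, b]‖ ≤ C * ((1 + a ^ 2)⁻¹ * (1 + b ^ 2)⁻¹) := by
  obtain ⟨C0, h0, H0⟩ := f.decay 0 0
  obtain ⟨C2, h2, H2⟩ := f.decay 2 0
  obtain ⟨C4, h4, H4⟩ := f.decay 4 0
  refine ⟨C0 + C2 + C4, by positivity, fun a b => ?_⟩
  have e0 := H0 !₂[a, b]
  have e2 := H2 !₂[a, b]
  have e4 := H4 !₂[a, b]
  have hn : ‖(!₂[a, b] : Plane)‖ ^ 2 = a ^ 2 + b ^ 2 := by
    simp [EuclideanSpace.norm_sq_eq]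
  have hn4 : ‖(!₂[a, b] : Plane)‖ ^ 4 = (a ^ 2 + b ^ 2) ^ 2 := by
    rw [← hn]; ring
  rw [hn4] at e4
  rw [hn] at e2
  simp only [norm_iteratedFDeriv_zero, pow_zero, one_mul] at e0 e2 e4
  rw [← mul_inv, ← div_eq_mul_inv, le_div_iff₀ (by positivity)]
  have : 0 ≤ ‖f !₂[a, b]‖ := norm_nonneg _
  nlinarith [mul_nonneg this (sq_nonneg (a ^ 2)), mul_nonneg this (sq_nonneg (b ^ 2)),
    mul_nonneg this (mul_nonneg (sq_nonneg a) (sq_nonneg b))]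

theorem continuous_mk : Continuous fun z : ℝ × ℝ => (!₂[z.1, z.2] : Plane) := by
  refine (PiLp.continuous_toLp 2 _).comp (continuous_pi fun i => ?_)
  fin_cases i
  · exact continuous_fst
  · exact continuous_snd

theorem norm_exp_I_mul (p t : ℝ) : ‖Complex.exp (Complex.I * p * t)‖ = 1 := by
  rw [Complex.norm_exp]; simp

/-- `kern lam f p y = ∫ exp (i p t) f (t, exp (-lam p) y) dt`. -/
def kern (lam : ℝ) (f : Plane → ℂ) (p y : ℝ) : ℂ :=
  ∫ t : ℝ, Complex.exp (Complex.I * p * t) * f !₂[t, Real.exp (-(lam * p)) * y]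

theorem integrable_slice (f : 𝓢(Plane, ℂ)) (p b : ℝ) :
    Integrable fun t : ℝ => Complex.exp (Complex.I * p * t) * f !₂[t, b] := by
  obtain ⟨C, hC, H⟩ := schwartz_bound f
  refine Integrable.mono' (integrable_inv_one_add_sq.const_mul C) ?_ (ae_of_all _ fun t => ?_)
  · refine Continuous.aestronglyMeasurable ?_
    refine Continuous.mul (by fun_prop) (f.continuous.comp ?_)
    exact continuous_mk.comp (by fun_prop : Continuous fun t : ℝ => (t, b))
  · rw [norm_mul, norm_exp_I_mul, one_mul]
    refine (H t b).trans ?_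
    gcongr
    have : (1 + b ^ 2)⁻¹ ≤ 1 := inv_le_one_of_one_le₀ (by nlinarith [sq_nonneg b])
    have h2 : 0 ≤ (1 + t ^ 2)⁻¹ := by positivity
    nlinarith

theorem kern_add (lam : ℝ) (f g : 𝓢(Plane, ℂ)) (p y : ℝ) :
    kern lam (f + g : 𝓢(Plane, ℂ)) p y = kern lam f p y + kern lam g p y := by
  unfold kern
  rw [← integral_add (integrable_slice f p _) (integrable_slice g p _)]
  simp [mul_add]

theorem kern_smul (lam : ℝ) (c : ℂ) (f : 𝓢(Plane, ℂ)) (p y : ℝ) :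
    kern lam (c • f : 𝓢(Plane, ℂ)) p y = c * kern lam f p y := by
  unfold kern
  rw [← integral_const_mul]
  congr 1; ext t; simp; ring

theorem continuous_kern (lam : ℝ) (f : 𝓢(Plane, ℂ)) :
    Continuous fun z : ℝ × ℝ => kern lam f z.1 z.2 := by
  obtain ⟨C, hC, H⟩ := schwartz_bound f
  unfold kern
  refine continuous_of_dominated (bound := fun t => C * (1 + t ^ 2)⁻¹) (fun z => ?_) (fun z => ?_)
    (integrable_inv_one_add_sq.const_mul C) (ae_of_all _ fun t => ?_)
  · exact (integrable_slice f z.1 _).aestronglyMeasurable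
  · refine ae_of_all _ fun t => ?_
    rw [norm_mul, norm_exp_I_mul, one_mul]
    refine (H t _).trans ?_
    gcongr
    have : (1 + (Real.exp (-(lam * z.1)) * z.2) ^ 2)⁻¹ ≤ 1 :=
      inv_le_one_of_one_le₀ (by nlinarith [sq_nonneg (Real.exp (-(lam * z.1)) * z.2)])
    have h2 : 0 ≤ (1 + t ^ 2)⁻¹ := by positivity
    nlinarith
  · refine Continuous.mul (by fun_prop) (f.continuous.comp ?_)
    exact continuous_mk.comp
      (by fun_prop : Continuous fun z : ℝ × ℝ => (t, Real.exp (-(lam * z.1)) * z.2))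

theorem kern_bound (lam : ℝ) (f : 𝓢(Plane, ℂ)) : ∃ C : ℝ, 0 < C ∧ ∀ p y : ℝ,
    ‖kern lam f p y‖ ≤ C * (1 + (Real.exp (-(lam * p)) * y) ^ 2)⁻¹ := by
  obtain ⟨C, hC, H⟩ := schwartz_bound f
  refine ⟨C * Real.pi, by positivity, fun p y => ?_⟩
  unfold kern
  refine (norm_integral_le_of_norm_le (g := fun t =>
    (C * (1 + (Real.exp (-(lam * p)) * y) ^ 2)⁻¹) * (1 + t ^ 2)⁻¹)
    (integrable_inv_one_add_sq.const_mul _) (ae_of_all _ fun t => ?_)).trans ?_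
  · rw [norm_mul, norm_exp_I_mul, one_mul]
    refine (H t _).trans (le_of_eq ?_)
    ring
  · rw [integral_const_mul, integral_univ_inv_one_add_sq]
    refine le_of_eq ?_
    ring

/-! ### Passing between the plane and `ℝ × ℝ` -/

theorem measurePreserving_mk :
    MeasurePreserving (fun z : ℝ × ℝ => (!₂[z.1, z.2] : Plane)) := by
  have h1 := (volume_preserving_finTwoArrow ℝ).symm
  have h2 := PiLp.volume_preserving_toLp (Fin 2)
  exact h2.comp h1

def mkEquiv : ℝ × ℝ ≃ᵐ Plane :=
  (MeasurableEquiv.finTwoArrow (α := ℝ)).symm.trans (MeasurableEquiv.toLp 2 (Fin 2 → ℝ))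

theorem mkEquiv_apply (z : ℝ × ℝ) : mkEquiv z = !₂[z.1, z.2] := rfl

theorem integral_plane (h : Plane → ℂ) :
    ∫ x : Plane, h x = ∫ z : ℝ × ℝ, h !₂[z.1, z.2] := by
  have := measurePreserving_mk
  exact (MeasurePreserving.integral_comp (f := fun z : ℝ × ℝ => (!₂[z.1, z.2] : Plane)) this
    mkEquiv.measurableEmbedding h).symm

theorem integrable_plane {h : Plane → ℂ} (hh : Integrable h) :
    Integrable fun z : ℝ × ℝ => h !₂[z.1, z.2] :=
  measurePreserving_mk.integrable_comp_of_integrable hh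

/-! ### Elements of `𝒜` -/

theorem mem_algA_iff {f : 𝓢(Plane, ℂ)} : f ∈ algA ↔ 𝓕⁻ f ∈ schwartzC := by
  unfold algA
  rw [Submodule.mem_map]
  constructor
  · rintro ⟨φ, h, rfl⟩
    simpa using h
  · intro h
    exact ⟨_, h, by simp⟩

theorem exists_bound_of_mem {φ : 𝓢(Plane, ℂ)} (h : φ ∈ schwartzC) :
    ∃ R : ℝ, 0 < R ∧ ∀ x : Plane, R < |x 0| → φ x = 0 := by
  obtain ⟨K, hK, hs⟩ := h
  obtain ⟨R, hR⟩ := hK.isBounded.subset_closedBall 0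
  refine ⟨max R 1, by positivity, fun x hx => ?_⟩
  by_contra hne
  have := hR (hs hne)
  simp only [Metric.mem_closedBall, dist_zero_right, Real.norm_eq_abs] at this
  have := le_max_left R 1
  linarith

theorem mem_schwartzC_of {φ : 𝓢(Plane, ℂ)} (R : ℝ) (h : ∀ x : Plane, R < |x 0| → φ x = 0) :
    φ ∈ schwartzC := by
  refine ⟨Set.Icc (-R) R, isCompact_Icc, fun x hx => ?_⟩
  have : |x 0| ≤ R := by
    by_contra h'
    exact hx (h x (not_le.mp h'))
  exact abs_le.mp this

/-- Fourier representation of an element of `𝒜` on a line `x₁ = const`. -/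
theorem apply_eq_fourier (f : 𝓢(Plane, ℂ)) (t b : ℝ) :
    f !₂[t, b] = ∫ z : ℝ × ℝ, Complex.exp (-(2 * Real.pi * Complex.I * (z.1 * t + z.2 * b))) *
      (𝓕⁻ f) !₂[z.1, z.2] := by
  have h : f !₂[t, b] = (𝓕 (𝓕⁻ f)) !₂[t, b] := by simp
  rw [h, SchwartzMap.fourier_coe, Real.fourier_eq', integral_plane]
  congr 1; ext z
  rw [smul_eq_mul]
  congr 2
  simp [PiLp.inner_apply, Fin.sum_univ_two]
  ring


/-- Fourier transform in the second variable. -/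
def fourier1 (φ : Plane → ℂ) (b q : ℝ) : ℂ :=
  ∫ r : ℝ, Complex.exp (-(2 * Real.pi * Complex.I * (r * b))) * φ !₂[q, r]

theorem norm_exp_neg_two_pi (a : ℝ) :
    ‖Complex.exp (-(2 * Real.pi * Complex.I * a))‖ = 1 := by
  rw [Complex.norm_exp]; simp

theorem norm_exp_neg_two_pi' (a b : ℝ) :
    ‖Complex.exp (-(2 * Real.pi * Complex.I * (a * b)))‖ = 1 := by
  have := norm_exp_neg_two_pi (a * b)
  rwa [Complex.ofReal_mul] at this

theorem continuous_fourier1 (φ : 𝓢(Plane, ℂ)) (b : ℝ) : Continuous (fourier1 φ b) := by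
  obtain ⟨C, hC, H⟩ := schwartz_bound φ
  unfold fourier1
  refine continuous_of_dominated (bound := fun r => C * (1 + r ^ 2)⁻¹) (fun q => ?_) (fun q => ?_)
    (integrable_inv_one_add_sq.const_mul C) (ae_of_all _ fun r => ?_)
  · refine Continuous.aestronglyMeasurable ?_
    refine Continuous.mul (by fun_prop) (φ.continuous.comp ?_)
    exact continuous_mk.comp (by fun_prop : Continuous fun t : ℝ => (q, t))
  · refine ae_of_all _ fun r => ?_
    rw [norm_mul, norm_exp_neg_two_pi', one_mul]
    refine (H q r).trans ?_
    gcongr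
    have : (1 + q ^ 2)⁻¹ ≤ 1 := inv_le_one_of_one_le₀ (by nlinarith [sq_nonneg q])
    have h2 : 0 ≤ (1 + r ^ 2)⁻¹ := by positivity
    nlinarith
  · refine Continuous.mul (by fun_prop) (φ.continuous.comp ?_)
    exact continuous_mk.comp (by fun_prop : Continuous fun t : ℝ => (t, r))

theorem fourier1_eq_zero {φ : 𝓢(Plane, ℂ)} {R : ℝ} (h : ∀ x : Plane, R < |x 0| → φ x = 0)
    (b : ℝ) {q : ℝ} (hq : R < |q|) : fourier1 φ b q = 0 := by
  unfold fourier1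
  rw [← integral_zero ℝ ℂ]
  congr 1; ext r
  rw [h _ (by simpa using hq), mul_zero]

theorem integrable_fourier1 {φ : 𝓢(Plane, ℂ)} (h : φ ∈ schwartzC) (b : ℝ) :
    Integrable (fourier1 φ b) := by
  obtain ⟨R, hR, H⟩ := exists_bound_of_mem h
  refine (continuous_fourier1 φ b).integrable_of_hasCompactSupport ?_
  refine HasCompactSupport.of_support_subset_isCompact (isCompact_Icc (a := -R) (b := R)) ?_
  intro q hq
  have : |q| ≤ R := by
    by_contra h'
    exact hq (fourier1_eq_zero H b (not_le.mp h'))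
  exact abs_le.mp this

theorem fourier_fourier1 (f : 𝓢(Plane, ℂ)) (b t : ℝ) :
    𝓕 (fourier1 (𝓕⁻ f : 𝓢(Plane, ℂ)) b) t = f !₂[t, b] := by
  have hint : Integrable fun z : ℝ × ℝ =>
      Complex.exp (-(2 * Real.pi * Complex.I * (z.1 * t + z.2 * b))) * (𝓕⁻ f) !₂[z.1, z.2] := by
    refine Integrable.bdd_mul (c := 1) (integrable_plane (𝓕⁻ f).integrable)
      (Continuous.aestronglyMeasurable (by fun_prop)) (ae_of_all _ fun z => ?_)
    have := norm_exp_neg_two_pi (z.1 * t + z.2 * b)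
    push_cast at this
    exact this.le
  rw [apply_eq_fourier, MeasureTheory.Measure.volume_eq_prod, integral_prod _ hint, Real.fourier_eq']
  congr 1; ext q
  simp only [fourier1, smul_eq_mul]
  rw [← integral_const_mul]
  congr 1; ext r
  rw [← mul_assoc, ← Complex.exp_add]
  congr 2
  simp
  ring

theorem kern_eq_fourier1 (lam : ℝ) {f : 𝓢(Plane, ℂ)} (hf : f ∈ algA) (p y : ℝ) :
    kern lam f p y = fourier1 (𝓕⁻ f : 𝓢(Plane, ℂ)) (Real.exp (-(lam * p)) * y) (p / (2 * Real.pi)) := by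
  set b := Real.exp (-(lam * p)) * y with hb
  have h1 : 𝓕 (fourier1 (𝓕⁻ f : 𝓢(Plane, ℂ)) b) = fun t => f !₂[t, b] :=
    funext fun t => fourier_fourier1 f b t
  have h2 : Integrable (𝓕 (fourier1 (𝓕⁻ f : 𝓢(Plane, ℂ)) b)) := by
    rw [h1]
    simpa using integrable_slice f 0 b
  have h3 := (continuous_fourier1 (𝓕⁻ f : 𝓢(Plane, ℂ)) b).fourierInv_fourier_eq
    (integrable_fourier1 (mem_algA_iff.mp hf) b) h2
  rw [← h3, h1, Real.fourierInv_eq']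
  unfold kern
  congr 1; ext t
  rw [smul_eq_mul, ← hb]
  congr 2
  simp only [RCLike.inner_apply, conj_trivial]
  push_cast
  field_simp

theorem kern_vanish (lam : ℝ) {f : 𝓢(Plane, ℂ)} (hf : f ∈ algA) :
    ∃ R : ℝ, 0 < R ∧ ∀ p y : ℝ, R < |p| → kern lam f p y = 0 := by
  obtain ⟨R, hR, H⟩ := exists_bound_of_mem (mem_algA_iff.mp hf)
  refine ⟨R * (2 * Real.pi), by positivity, fun p y hp => ?_⟩
  rw [kern_eq_fourier1 lam hf]
  refine fourier1_eq_zero H _ ?_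
  rw [abs_div, lt_div_iff₀ (by positivity), abs_of_pos (by positivity : 0 < 2 * Real.pi)]
  exact hp

theorem eq_zero_of_kern (lam : ℝ) {f : 𝓢(Plane, ℂ)} (hf : f ∈ algA)
    (h : ∀ p y, kern lam f p y = 0) : f = 0 := by
  ext x
  have hx : x = !₂[x 0, x 1] := by
    ext i; fin_cases i <;> rfl
  have h0 : fourier1 (𝓕⁻ f : 𝓢(Plane, ℂ)) (x 1) = fun _ => 0 := by
    ext q
    have := kern_eq_fourier1 lam hf (2 * Real.pi * q) (Real.exp (lam * (2 * Real.pi * q)) * x 1)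
    rw [h, ← mul_assoc, ← Real.exp_add] at this
    have e : 2 * Real.pi * q / (2 * Real.pi) = q := by field_simp
    rw [e] at this
    simpa using this.symm
  rw [hx, ← fourier_fourier1, h0, Real.fourier_eq']
  simp

theorem integrable_bound (lam : ℝ) {f : 𝓢(Plane, ℂ)} (hf : f ∈ algA) (g : 𝓢(Plane, ℂ)) :
    ∃ C R : ℝ, 0 < C ∧ 0 < R ∧ ∀ p y a : ℝ,
      ‖conj (kern lam f p y)‖ * ‖g !₂[a, Real.exp (-(lam * p)) * y]‖ ≤
        (C * ((1 + a ^ 2)⁻¹ * (1 + y ^ 2)⁻¹)) * (Set.Icc (-R) R).indicator (fun _ => (1 : ℝ)) p := by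
  obtain ⟨R, hR, H⟩ := kern_vanish lam hf
  obtain ⟨C, hC, HC⟩ := kern_bound lam f
  obtain ⟨D, hD, HD⟩ := schwartz_bound g
  set m := Real.exp (-(|lam| * R)) with hm
  have hm0 : 0 < m := Real.exp_pos _
  have hm1 : m ≤ 1 := Real.exp_le_one_iff.mpr (by have := abs_nonneg lam; nlinarith)
  refine ⟨C * D * (m ^ 2)⁻¹, R, by positivity, hR, fun p y a => ?_⟩
  by_cases hp : R < |p|
  · rw [H p y hp]
    simp only [map_zero, norm_zero, zero_mul]
    refine mul_nonneg (by positivity) (Set.indicator_nonneg (fun _ _ => zero_le_one) _)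
  · push Not at hp
    rw [Set.indicator_of_mem (by exact abs_le.mp hp), mul_one, RCLike.norm_conj]
    have h1 : ‖kern lam f p y‖ ≤ C := by
      refine (HC p y).trans ?_
      have : (1 + (Real.exp (-(lam * p)) * y) ^ 2)⁻¹ ≤ 1 :=
        inv_le_one_of_one_le₀ (by nlinarith [sq_nonneg (Real.exp (-(lam * p)) * y)])
      nlinarith
    have h2 : (1 + (Real.exp (-(lam * p)) * y) ^ 2)⁻¹ ≤ (m ^ 2)⁻¹ * (1 + y ^ 2)⁻¹ := by
      rw [← mul_inv]
      refine inv_anti₀ (by positivity) ?_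
      have h3 : m ≤ Real.exp (-(lam * p)) := by
        refine Real.exp_le_exp.mpr (neg_le_neg ?_)
        calc lam * p ≤ |lam * p| := le_abs_self _
          _ = |lam| * |p| := abs_mul _ _
          _ ≤ |lam| * R := by gcongr
      have h4 : m ^ 2 ≤ Real.exp (-(lam * p)) ^ 2 := by gcongr
      have h5 : m ^ 2 ≤ 1 := by nlinarith
      rw [mul_pow]
      nlinarith [mul_le_mul_of_nonneg_right h4 (sq_nonneg y)]
    calc ‖kern lam f p y‖ * ‖g !₂[a, Real.exp (-(lam * p)) * y]‖
        ≤ C * (D * ((1 + a ^ 2)⁻¹ * ((m ^ 2)⁻¹ * (1 + y ^ 2)⁻¹))) := by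
          refine mul_le_mul h1 ((HD _ _).trans ?_) (norm_nonneg _) hC.le
          gcongr
      _ = _ := by ring

/-- The kernel `kern lam f` is, as a function of `p`, differentiable with derivative of the same
form. -/
theorem hasDerivAt_kern (lam : ℝ) (f : 𝓢(Plane, ℂ)) : ∃ g : 𝓢(Plane, ℂ), ∀ y p,
    HasDerivAt (fun p => kern lam f p y) (kern lam g p y) p := by
  have hg0 : Function.HasTemperateGrowth (fun x : Plane => (x 0 : ℂ)) := by
    have : (fun x : Plane => (x 0 : ℂ)) =
      (Complex.ofRealCLM.comp (EuclideanSpace.proj (𝕜 := ℝ) (0 : Fin 2))) := rfl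
    rw [this]; exact ContinuousLinearMap.hasTemperateGrowth _
  have hg1 : Function.HasTemperateGrowth (fun x : Plane => (x 1 : ℂ)) := by
    have : (fun x : Plane => (x 1 : ℂ)) =
      (Complex.ofRealCLM.comp (EuclideanSpace.proj (𝕜 := ℝ) (1 : Fin 2))) := rfl
    rw [this]; exact ContinuousLinearMap.hasTemperateGrowth _
  let e1 : Plane := EuclideanSpace.single 1 1
  let g : 𝓢(Plane, ℂ) := Complex.I • SchwartzMap.smulLeftCLM ℂ (fun x : Plane => (x 0 : ℂ)) f -
    (lam : ℂ) • SchwartzMap.smulLeftCLM ℂ (fun x : Plane => (x 1 : ℂ)) (∂_{e1} f)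
  have hga : ∀ x : Plane, g x = Complex.I * (x 0 * f x) - lam * (x 1 * fderiv ℝ f x e1) := by
    intro x
    simp [g, SchwartzMap.smulLeftCLM_apply_apply hg0, SchwartzMap.smulLeftCLM_apply_apply hg1,
      SchwartzMap.lineDerivOp_apply_eq_fderiv]
  refine ⟨g, fun y p => ?_⟩
  obtain ⟨C, hC, H⟩ := schwartz_bound g
  have key := hasDerivAt_integral_of_dominated_loc_of_deriv_le (𝕜 := ℝ) (μ := volume)
    (F := fun (p t : ℝ) => Complex.exp (Complex.I * p * t) * f !₂[t, Real.exp (-(lam * p)) * y])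
    (F' := fun (p t : ℝ) => Complex.exp (Complex.I * p * t) * g !₂[t, Real.exp (-(lam * p)) * y])
    (x₀ := p) (s := Set.univ) (bound := fun t => C * (1 + t ^ 2)⁻¹) Filter.univ_mem
    (Filter.Eventually.of_forall fun p => (integrable_slice f p _).aestronglyMeasurable)
    (integrable_slice f p _) (integrable_slice g p _).aestronglyMeasurable
    (ae_of_all _ fun t p _ => ?_) (integrable_inv_one_add_sq.const_mul C)
    (ae_of_all _ fun t p _ => ?_)
  · exact key.2
  · rw [norm_mul, norm_exp_I_mul, one_mul]
    refine (H t _).trans ?_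
    gcongr
    have : (1 + (Real.exp (-(lam * p)) * y) ^ 2)⁻¹ ≤ 1 :=
      inv_le_one_of_one_le₀ (by nlinarith [sq_nonneg (Real.exp (-(lam * p)) * y)])
    have h2 : 0 ≤ (1 + t ^ 2)⁻¹ := by positivity
    nlinarith
  · have d1 : HasDerivAt (fun p : ℝ => Complex.exp (Complex.I * p * t))
        (Complex.exp (Complex.I * p * t) * (Complex.I * t)) p := by
      have h0 : HasDerivAt (fun z : ℂ => Complex.I * z * t) (Complex.I * t) (p : ℂ) := by
        simpa using ((hasDerivAt_id (p : ℂ)).const_mul Complex.I).mul_const (t : ℂ)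
      exact h0.cexp.comp_ofReal
    have d2 : HasDerivAt (fun p : ℝ => Real.exp (-(lam * p)) * y)
        (-lam * (Real.exp (-(lam * p)) * y)) p := by
      have h0 : HasDerivAt (fun p : ℝ => -(lam * p)) (-lam) p := by
        have h := (hasDerivAt_id' p).const_mul (-lam)
        rw [mul_one] at h
        exact h.congr_of_eventuallyEq (Filter.Eventually.of_forall fun q => by ring)
      exact (h0.exp.mul_const y).congr_deriv (by ring)
    have d3 : HasDerivAt (fun p : ℝ => (!₂[t, Real.exp (-(lam * p)) * y] : Plane))
        ((-lam * (Real.exp (-(lam * p)) * y)) • e1) p := by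
      have e : (fun p : ℝ => (!₂[t, Real.exp (-(lam * p)) * y] : Plane)) =
          fun p => !₂[t, 0] + (Real.exp (-(lam * p)) * y) • e1 := by
        ext q i
        fin_cases i <;> simp [e1]
      rw [e]
      exact (d2.smul_const e1).const_add _
    have d4 := (f.differentiableAt (x := !₂[t, Real.exp (-(lam * p)) * y])).hasFDerivAt.comp_hasDerivAt
      p d3
    refine (d1.mul d4).congr_deriv ?_
    rw [hga]
    simp
    ring

theorem contDiff_kern (lam : ℝ) (n : ℕ) : ∀ (f : 𝓢(Plane, ℂ)) (y : ℝ),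
    ContDiff ℝ n fun p => kern lam f p y := by
  induction n with
  | zero =>
    intro f y
    refine contDiff_zero.mpr ?_
    exact (continuous_kern lam f).comp (by fun_prop : Continuous fun p : ℝ => (p, y))
  | succ n ih =>
    intro f y
    obtain ⟨g, hg⟩ := hasDerivAt_kern lam f
    push_cast
    refine contDiff_succ_iff_deriv.mpr ⟨fun p => (hg y p).differentiableAt, by simp, ?_⟩
    have : deriv (fun p => kern lam f p y) = fun p => kern lam g p y :=
      funext fun p => (hg y p).deriv
    rw [this]
    exact ih g y

theorem fourier0_conj (lam : ℝ) (f : Plane → ℂ) (p y : ℝ) :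
    fourier0 (fun x => conj (f x)) p (Real.exp (-(lam * p)) * y) = conj (kern lam f p y) := by
  unfold fourier0 kern
  rw [← integral_conj]
  congr 1; ext t
  rw [map_mul, ← Complex.exp_conj]
  simp

/-- `conj (kern lam f · y)` as a Schwartz function on the line. -/
theorem exists_schwartz (lam : ℝ) {f : 𝓢(Plane, ℂ)} (hf : f ∈ algA) (y : ℝ) :
    ∃ ψ : 𝓢(ℝ, ℂ), ∀ p, ψ p = conj (kern lam f p y) := by
  obtain ⟨R, hR, H⟩ := kern_vanish lam hf
  have h1 : HasCompactSupport fun p => conj (kern lam f p y) := by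
    refine HasCompactSupport.of_support_subset_isCompact (isCompact_Icc (a := -R) (b := R)) ?_
    intro q hq
    have : |q| ≤ R := by
      by_contra h'
      exact hq (by simp [H q y (not_le.mp h')])
    exact abs_le.mp this
  have h2 : ContDiff ℝ (⊤ : ℕ∞) fun p => conj (kern lam f p y) := by
    refine contDiff_infty.mpr fun n => ?_
    exact Complex.conjCLE.contDiff.comp (contDiff_kern lam n f y)
  exact ⟨h1.toSchwartzMap h2, fun p => rfl⟩

theorem fourier0_starInv (lam : ℝ) {f : 𝓢(Plane, ℂ)} (hf : f ∈ algA) (k y : ℝ) :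
    fourier0 (starInv lam f) k y = conj (kern lam f k y) := by
  obtain ⟨ψ, hψ⟩ := exists_schwartz lam hf y
  have h1 : ∀ t : ℝ, starInv lam f !₂[t, y] =
      (2 * Real.pi : ℂ)⁻¹ * (𝓕⁻ ψ) (t / (2 * Real.pi)) := by
    intro t
    unfold starInv
    rw [SchwartzMap.fourierInv_coe, Real.fourierInv_eq']
    congr 2; ext p
    have := fourier0_conj lam f p y
    simp only [Matrix.cons_val_zero, Matrix.cons_val_one, smul_eq_mul]
    rw [this, hψ]
    congr 2
    simp only [RCLike.inner_apply, conj_trivial]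
    push_cast
    field_simp
  have h2 : (𝓕 (𝓕⁻ ψ)) k = ψ k := by simp
  rw [← hψ, ← h2, SchwartzMap.fourier_coe, Real.fourier_eq']
  unfold fourier0
  have h3 := MeasureTheory.Measure.integral_comp_div
    (fun s : ℝ => Complex.exp (-(Complex.I * k * (2 * Real.pi * s))) * (𝓕⁻ ψ) s) (2 * Real.pi)
  rw [abs_of_pos (by positivity)] at h3
  calc ∫ t : ℝ, Complex.exp (-(Complex.I * k * t)) * starInv lam f !₂[t, y]
      = (2 * Real.pi : ℂ)⁻¹ * ∫ t : ℝ, Complex.exp (-(Complex.I * k *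
          (2 * Real.pi * ((t / (2 * Real.pi) : ℝ) : ℂ)))) * (𝓕⁻ ψ) (t / (2 * Real.pi)) := by
        rw [← integral_const_mul]
        congr 1; ext t
        rw [h1]
        have : (2 * Real.pi * ((t / (2 * Real.pi) : ℝ) : ℂ)) = t := by
          push_cast; field_simp
        rw [this]; ring
    _ = ∫ s : ℝ, Complex.exp (-(Complex.I * k * (2 * Real.pi * s))) * (𝓕⁻ ψ) s := by
        rw [h3, Complex.real_smul, ← mul_assoc]
        push_cast
        rw [inv_mul_cancel₀ (by simp [Real.pi_ne_zero]), one_mul]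
    _ = _ := by
        congr 1; ext s
        rw [smul_eq_mul]
        congr 2
        simp
        ring

theorem integrable_kern_mul (lam : ℝ) {f : 𝓢(Plane, ℂ)} (hf : f ∈ algA) (g : 𝓢(Plane, ℂ)) :
    Integrable fun w : (ℝ × ℝ) × ℝ => Complex.exp (Complex.I * w.2 * w.1.1) *
      conj (kern lam f w.2 w.1.2) * g !₂[w.1.1, Real.exp (-(lam * w.2)) * w.1.2] := by
  obtain ⟨C, R, hC, hR, H⟩ := integrable_bound lam hf g
  have hi : Integrable fun w : (ℝ × ℝ) × ℝ =>
      (C * ((1 + w.1.1 ^ 2)⁻¹ * (1 + w.1.2 ^ 2)⁻¹)) *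
        (Set.Icc (-R) R).indicator (fun _ => (1 : ℝ)) w.2 := by
    have i1 : Integrable fun z : ℝ × ℝ => C * ((1 + z.1 ^ 2)⁻¹ * (1 + z.2 ^ 2)⁻¹) :=
      (integrable_inv_one_add_sq.mul_prod integrable_inv_one_add_sq).const_mul C
    have i2 : Integrable ((Set.Icc (-R) R).indicator (fun _ => (1 : ℝ))) :=
      (integrable_indicator_iff measurableSet_Icc).mpr (integrableOn_const (by simp))
    exact i1.mul_prod i2
  refine hi.mono' (Continuous.aestronglyMeasurable ?_) (ae_of_all _ fun w => ?_)
  · have c1 : Continuous fun w : (ℝ × ℝ) × ℝ => kern lam f w.2 w.1.2 :=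
      (continuous_kern lam f).comp (by fun_prop : Continuous fun w : (ℝ × ℝ) × ℝ => (w.2, w.1.2))
    have c2 : Continuous fun w : (ℝ × ℝ) × ℝ => g !₂[w.1.1, Real.exp (-(lam * w.2)) * w.1.2] :=
      g.continuous.comp (continuous_mk.comp (by fun_prop :
        Continuous fun w : (ℝ × ℝ) × ℝ => (w.1.1, Real.exp (-(lam * w.2)) * w.1.2)))
    have c3 : Continuous fun w : (ℝ × ℝ) × ℝ => conj (kern lam f w.2 w.1.2) :=
      Complex.continuous_conj.comp c1
    exact ((by fun_prop : Continuous fun w : (ℝ × ℝ) × ℝ =>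
      Complex.exp (Complex.I * w.2 * w.1.1)).mul c3).mul c2
  · rw [norm_mul, norm_mul, norm_exp_I_mul, one_mul]
    exact H w.2 w.1.2 w.1.1

/-- On `𝒜` the GNS form is an `L²` product of the kernels. -/
theorem gnsForm_eq (lam : ℝ) {f g : 𝓢(Plane, ℂ)} (hf : f ∈ algA) :
    gnsForm lam f g = (2 * Real.pi : ℂ)⁻¹ *
      ∫ z : ℝ × ℝ, conj (kern lam f z.2 z.1) * kern lam g z.2 z.1 := by
  have hI := integrable_kern_mul lam hf g
  unfold gnsForm weight starProd
  rw [integral_plane, integral_const_mul]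
  congr 1
  simp only [Matrix.cons_val_zero, Matrix.cons_val_one]
  simp_rw [fourier0_starInv lam hf]
  refine Eq.trans (integral_prod _ hI).symm ?_
  have e2 := (measurePreserving_prodAssoc (volume : Measure ℝ) (volume : Measure ℝ)
    (volume : Measure ℝ)).integral_comp (MeasurableEquiv.measurableEmbedding _)
    (fun w : ℝ × (ℝ × ℝ) => Complex.exp (Complex.I * w.2.2 * w.1) *
      conj (kern lam f w.2.2 w.2.1) * g !₂[w.1, Real.exp (-(lam * w.2.2)) * w.2.1])
  have hI2 := (measurePreserving_prodAssoc (volume : Measure ℝ) (volume : Measure ℝ)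
    (volume : Measure ℝ)).integrable_comp_emb (MeasurableEquiv.measurableEmbedding _)
    (g := fun w : ℝ × (ℝ × ℝ) => Complex.exp (Complex.I * w.2.2 * w.1) *
      conj (kern lam f w.2.2 w.2.1) * g !₂[w.1, Real.exp (-(lam * w.2.2)) * w.2.1])
  refine Eq.trans e2 ?_
  rw [integral_prod_symm _ (hI2.mp hI)]
  congr 1; ext z
  unfold kern
  rw [← integral_const_mul]
  congr 1; ext t
  ring

theorem integrable_kern_kern (lam : ℝ) {f : 𝓢(Plane, ℂ)} (hf : f ∈ algA) (g : 𝓢(Plane, ℂ)) :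
    Integrable fun z : ℝ × ℝ => conj (kern lam f z.2 z.1) * kern lam g z.2 z.1 := by
  have hI := integrable_kern_mul lam hf g
  have hI2 := (measurePreserving_prodAssoc (volume : Measure ℝ) (volume : Measure ℝ)
    (volume : Measure ℝ)).integrable_comp_emb (MeasurableEquiv.measurableEmbedding _)
    (g := fun w : ℝ × (ℝ × ℝ) => Complex.exp (Complex.I * w.2.2 * w.1) *
      conj (kern lam f w.2.2 w.2.1) * g !₂[w.1, Real.exp (-(lam * w.2.2)) * w.2.1])
  refine ((hI2.mp hI).integral_prod_right).congr (ae_of_all _ fun z => ?_)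
  unfold kern
  simp only
  rw [← integral_const_mul]
  congr 1; ext t
  ring

/-! ### The GNS Hilbert space -/

theorem kern_inner_conj (lam : ℝ) (f g : 𝓢(Plane, ℂ)) :
    conj (∫ z : ℝ × ℝ, conj (kern lam g z.2 z.1) * kern lam f z.2 z.1) =
      ∫ z : ℝ × ℝ, conj (kern lam f z.2 z.1) * kern lam g z.2 z.1 := by
  rw [← integral_conj]
  congr 1; ext z
  simp [mul_comm]

theorem kern_inner_self (lam : ℝ) (f : 𝓢(Plane, ℂ)) :
    ∫ z : ℝ × ℝ, conj (kern lam f z.2 z.1) * kern lam f z.2 z.1 =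
      ((∫ z : ℝ × ℝ, ‖kern lam f z.2 z.1‖ ^ 2 : ℝ) : ℂ) := by
  have := integral_ofReal (𝕜 := ℂ) (μ := (volume : Measure (ℝ × ℝ)))
    (f := fun z : ℝ × ℝ => ‖kern lam f z.2 z.1‖ ^ 2)
  refine Eq.trans ?_ this
  congr 1; ext z
  rw [Complex.conj_mul']
  simp

/-- The algebra `𝒜`, viewed as a pre-Hilbert space with the inner product `(f, g) = ω(f^* ⋆ g)`. -/
def PreGNS (_lam : ℝ) : Type := algA

instance (lam : ℝ) : AddCommGroup (PreGNS lam) := inferInstanceAs (AddCommGroup algA)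

instance (lam : ℝ) : Module ℂ (PreGNS lam) := inferInstanceAs (Module ℂ algA)

/-- The identity map `𝒜 → PreGNS`. -/
def toPreGNS (lam : ℝ) : algA ≃ₗ[ℂ] PreGNS lam := LinearEquiv.refl ℂ algA

theorem two_pi_inv_eq : (2 * Real.pi : ℂ)⁻¹ = (((2 * Real.pi)⁻¹ : ℝ) : ℂ) := by push_cast; rfl

/-- The inner product is `(f, g) = ω(f^* ⋆ g)`, antilinear in the first argument; it is positive
definite on `𝒜`. -/
@[reducible]
def preGNSCore (lam : ℝ) : InnerProductSpace.Core ℂ (PreGNS lam) where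
  inner f g := gnsForm lam (((toPreGNS lam).symm f : algA) : 𝓢(Plane, ℂ))
    (((toPreGNS lam).symm g : algA) : 𝓢(Plane, ℂ))
  conj_inner_symm f g := by
    rw [gnsForm_eq lam ((toPreGNS lam).symm f).2, gnsForm_eq lam ((toPreGNS lam).symm g).2,
      two_pi_inv_eq, map_mul, Complex.conj_ofReal, kern_inner_conj]
  re_inner_nonneg f := by
    rw [gnsForm_eq lam ((toPreGNS lam).symm f).2, two_pi_inv_eq, kern_inner_self,
      ← Complex.ofReal_mul]
    simp only [RCLike.re_to_complex, Complex.ofReal_re]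
    exact mul_nonneg (by positivity) (integral_nonneg fun z => by positivity)
  add_left f g h := by
    rw [map_add, gnsForm_eq lam ((toPreGNS lam).symm f).2,
      gnsForm_eq lam ((toPreGNS lam).symm g).2, Submodule.coe_add,
      gnsForm_eq lam (algA.add_mem ((toPreGNS lam).symm f).2 ((toPreGNS lam).symm g).2),
      ← mul_add, ← integral_add (integrable_kern_kern lam ((toPreGNS lam).symm f).2 _)
        (integrable_kern_kern lam ((toPreGNS lam).symm g).2 _)]
    congr 2; ext z
    rw [kern_add, map_add, add_mul]
  smul_left f g c := by
    rw [map_smul, gnsForm_eq lam ((toPreGNS lam).symm f).2, Submodule.coe_smul,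
      gnsForm_eq lam (algA.smul_mem c ((toPreGNS lam).symm f).2),
      mul_left_comm (conj c), ← integral_const_mul (conj c)]
    refine congrArg (fun w : ℂ => (2 * Real.pi : ℂ)⁻¹ * w) (integral_congr_ae
      (ae_of_all _ fun z => ?_))
    simp only [kern_smul, map_mul, mul_assoc]
  definite f hf := by
    have h0 := hf
    rw [gnsForm_eq lam ((toPreGNS lam).symm f).2, two_pi_inv_eq, kern_inner_self,
      ← Complex.ofReal_mul, Complex.ofReal_eq_zero, mul_eq_zero] at h0
    have h1 := h0.resolve_left (by positivity)
    set f0 : 𝓢(Plane, ℂ) := (((toPreGNS lam).symm f : algA) : 𝓢(Plane, ℂ)) with hf0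
    have hc : Continuous fun z : ℝ × ℝ => kern lam f0 z.2 z.1 :=
      (continuous_kern lam f0).comp (by fun_prop : Continuous fun z : ℝ × ℝ => (z.2, z.1))
    have hi : Integrable fun z : ℝ × ℝ => ‖kern lam f0 z.2 z.1‖ ^ 2 := by
      refine (integrable_kern_kern lam ((toPreGNS lam).symm f).2 f0).norm.congr
        (ae_of_all _ fun z => ?_)
      simp only [norm_mul, RCLike.norm_conj, ← hf0, sq]
    have h2 := (integral_eq_zero_iff_of_nonneg (fun z => by positivity) hi).mp h1
    have h3 := ((hc.norm.pow 2).ae_eq_iff_eq volume continuous_zero).mp h2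
    have h4 : f0 = 0 := by
      refine eq_zero_of_kern lam ((toPreGNS lam).symm f).2 fun p y => ?_
      have := congrFun h3 (y, p)
      simpa using this
    have h5 : (toPreGNS lam).symm f = 0 := Subtype.ext h4
    simpa using h5

instance (lam : ℝ) : NormedAddCommGroup (PreGNS lam) := (preGNSCore lam).toNormedAddCommGroup

instance (lam : ℝ) : InnerProductSpace ℂ (PreGNS lam) :=
  InnerProductSpace.ofCore (preGNSCore lam).toCore

/-- The GNS Hilbert space `ℋ`: the completion of `𝒜` in the norm induced by `ω(f^* ⋆ g)`. -/
abbrev GNSHilbert (lam : ℝ) : Type := UniformSpace.Completion (PreGNS lam)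

/-- The canonical embedding `𝒜 → ℋ`. -/
def toGNS (lam : ℝ) : algA →ₗ[ℂ] GNSHilbert lam :=
  (UniformSpace.Completion.toComplₗᵢ (𝕜 := ℂ) (E := PreGNS lam)).toLinearMap ∘ₗ
    (toPreGNS lam).toLinearMap

theorem toGNS_injective (lam : ℝ) : Function.Injective (toGNS lam) :=
  (UniformSpace.Completion.toComplₗᵢ (𝕜 := ℂ) (E := PreGNS lam)).injective.comp
    (toPreGNS lam).injective

theorem inner_toGNS (lam : ℝ) (f g : algA) :
    inner ℂ (toGNS lam f) (toGNS lam g) = gnsForm lam (f : 𝓢(Plane, ℂ)) (g : 𝓢(Plane, ℂ)) :=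
  UniformSpace.Completion.inner_coe _ _

/-- `𝒜` as a subspace of `ℋ`. -/
def gnsDomain (lam : ℝ) : Submodule ℂ (GNSHilbert lam) := LinearMap.range (toGNS lam)

/-- `𝒜` is identified with its image in `ℋ`. -/
def algAEquivDomain (lam : ℝ) : algA ≃ₗ[ℂ] gnsDomain lam :=
  LinearEquiv.ofInjective (toGNS lam) (toGNS_injective lam)

/-! ### The action of the extended momentum algebra on `𝒜` -/

open Classical in
/-- The entire extension in the first variable of `x₀ ↦ f (x₀, b)`
(with junk value `0` if there is none). -/
def entireExt (f : Plane → ℂ) (b : ℝ) : ℂ → ℂ :=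
  if h : ∃ F : ℂ → ℂ, Differentiable ℂ F ∧ ∀ t : ℝ, F t = f !₂[t, b] then h.choose else 0

theorem entireExt_eq {f : Plane → ℂ} {b : ℝ} {F : ℂ → ℂ} (hF : Differentiable ℂ F)
    (h : ∀ t : ℝ, F t = f !₂[t, b]) : entireExt f b = F := by
  have hex : ∃ F : ℂ → ℂ, Differentiable ℂ F ∧ ∀ t : ℝ, F t = f !₂[t, b] := ⟨F, hF, h⟩
  rw [entireExt, dif_pos hex]
  obtain ⟨h1, h2⟩ := hex.choose_spec
  have a1 : AnalyticOnNhd ℂ hex.choose Set.univ :=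
    fun z _ => h1.analyticAt z
  have a2 : AnalyticOnNhd ℂ F Set.univ := fun z _ => hF.analyticAt z
  refine a1.eq_of_frequently_eq (z₀ := 0) a2 ?_
  have ht : Filter.Tendsto (fun t : ℝ => (t : ℂ)) (nhdsWithin 0 {0}ᶜ) (nhdsWithin 0 {0}ᶜ) := by
    refine tendsto_nhdsWithin_iff.mpr ⟨?_, ?_⟩
    · have : Filter.Tendsto (fun t : ℝ => (t : ℂ)) (nhds 0) (nhds 0) := by
        simpa using Complex.continuous_ofReal.tendsto (0 : ℝ)
      exact this.mono_left nhdsWithin_le_nhds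
    · filter_upwards [self_mem_nhdsWithin] with t ht0
      simpa using ht0
  refine ht.frequently (Filter.Frequently.of_forall fun t => ?_)
  rw [h2, h]

/-- `x ↦ f (x₀ + i lam, x₁)`. -/
def imShift (lam : ℝ) (f : Plane → ℂ) (x : Plane) : ℂ :=
  entireExt f (x 1) (x 0 + Complex.I * lam)

theorem exists_mul_exp {φ : 𝓢(Plane, ℂ)} (h : φ ∈ schwartzC) (c : ℝ) :
    ∃ ψ ∈ schwartzC, ∀ p, ψ p = Complex.exp (c * p 0) * φ p := by
  obtain ⟨R, hR, H⟩ := exists_bound_of_mem h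
  obtain ⟨χ, hχ1, hχ2, hχ3⟩ : ∃ χ : ℝ → ℝ, HasCompactSupport χ ∧ ContDiff ℝ (⊤ : ℕ∞) χ ∧
      ∀ s, |s| ≤ R → χ s = 1 := by
    refine ⟨(⟨R, R + 1, hR, by linarith⟩ : ContDiffBump (0 : ℝ)), ContDiffBump.hasCompactSupport _,
      ContDiffBump.contDiff _, fun s hs => ContDiffBump.one_of_mem_closedBall _ ?_⟩
    simpa using hs
  let u : ℝ → ℂ := fun s => (χ s : ℂ) * Complex.exp (c * s)
  have hu1 : HasCompactSupport u := by
    have : HasCompactSupport fun s => (χ s : ℂ) := hχ1.comp_left (g := Complex.ofReal) (by simp)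
    exact this.mul_right
  have hu2 : ContDiff ℝ (⊤ : ℕ∞) u := by
    have h1 : ContDiff ℝ (⊤ : ℕ∞) fun s => (χ s : ℂ) := Complex.ofRealCLM.contDiff.comp hχ2
    have h2 : ContDiff ℝ (⊤ : ℕ∞) fun s : ℝ => (c : ℂ) * (s : ℂ) :=
      contDiff_const.mul Complex.ofRealCLM.contDiff
    exact h1.mul h2.cexp
  have hu3 : Function.HasTemperateGrowth u := hu1.hasTemperateGrowth hu2
  have hu4 : Function.HasTemperateGrowth fun x : Plane => u (x 0) :=
    hu3.comp (ContinuousLinearMap.hasTemperateGrowth (EuclideanSpace.proj (𝕜 := ℝ) (0 : Fin 2)))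
  have hval : ∀ p, SchwartzMap.smulLeftCLM ℂ (fun x : Plane => u (x 0)) φ p =
      Complex.exp (c * p 0) * φ p := by
    intro p
    rw [SchwartzMap.smulLeftCLM_apply_apply hu4, smul_eq_mul]
    by_cases hp : R < |p 0|
    · rw [H p hp]; simp
    · have : χ (p 0) = 1 := hχ3 _ (not_lt.mp hp)
      simp [u, this]
  exact ⟨_, mem_schwartzC_of R fun x hx => by rw [hval, H x hx, mul_zero], hval⟩

theorem differentiable_laplace {G : ℝ → ℂ} (hG : Continuous G) {R : ℝ} (hR : 0 < R)
    (h : ∀ q, R < |q| → G q = 0) (hi : Integrable G) :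
    Differentiable ℂ fun z : ℂ => ∫ q : ℝ, Complex.exp (-(2 * Real.pi * Complex.I * q * z)) * G q := by
  intro z0
  have hb : ∀ (q : ℝ) (z : ℂ), z ∈ Metric.ball z0 1 →
      ‖Complex.exp (-(2 * Real.pi * Complex.I * q * z)) * G q‖ ≤
        Real.exp (2 * Real.pi * R * (‖z0‖ + 1)) * ‖G q‖ := by
    intro q z hz
    by_cases hq : R < |q|
    · rw [h q hq]; simp
    · push Not at hq
      rw [norm_mul]
      gcongr
      rw [Complex.norm_exp]
      refine Real.exp_le_exp.mpr ((Complex.re_le_norm _).trans ?_)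
      have hz' : ‖z‖ ≤ ‖z0‖ + 1 := by
        have h1 : ‖z - z0‖ < 1 := by simpa [dist_eq_norm] using hz
        have h2 := norm_add_le z0 (z - z0)
        rw [add_sub_cancel] at h2
        linarith
      rw [norm_neg, norm_mul, norm_mul, norm_mul, norm_mul]
      simp only [Complex.norm_ofNat, Complex.norm_real, Complex.norm_I, mul_one, Real.norm_eq_abs,
        abs_of_pos Real.pi_pos]
      gcongr
  have hcont : ∀ z : ℂ, Continuous fun q : ℝ =>
      Complex.exp (-(2 * Real.pi * Complex.I * q * z)) * G q := fun z =>
    Continuous.mul (by fun_prop) hG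
  have key := hasDerivAt_integral_of_dominated_loc_of_deriv_le (𝕜 := ℂ) (μ := volume)
    (F := fun (z : ℂ) (q : ℝ) => Complex.exp (-(2 * Real.pi * Complex.I * q * z)) * G q)
    (F' := fun (z : ℂ) (q : ℝ) =>
      -(2 * Real.pi * Complex.I * q) * (Complex.exp (-(2 * Real.pi * Complex.I * q * z)) * G q))
    (x₀ := z0) (s := Metric.ball z0 1)
    (bound := fun q => 2 * Real.pi * R * (Real.exp (2 * Real.pi * R * (‖z0‖ + 1)) * ‖G q‖))
    (Metric.ball_mem_nhds z0 one_pos)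
    (Filter.Eventually.of_forall fun z => (hcont z).aestronglyMeasurable)
    ?_ ?_ (ae_of_all _ fun q z hz => ?_) ((hi.norm.const_mul _).const_mul _)
    (ae_of_all _ fun q z hz => ?_)
  · exact key.2.differentiableAt
  · refine (hi.norm.const_mul (Real.exp (2 * Real.pi * R * (‖z0‖ + 1)))).mono'
      (hcont z0).aestronglyMeasurable (ae_of_all _ fun q => hb q z0 (Metric.mem_ball_self one_pos))
  · exact (Continuous.mul (by fun_prop) (hcont z0)).aestronglyMeasurable
  · by_cases hq : R < |q|
    · rw [h q hq]; simp
    · push Not at hq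
      rw [norm_mul]
      refine mul_le_mul ?_ (hb q z hz) (norm_nonneg _) (by positivity)
      rw [norm_neg, norm_mul, norm_mul, norm_mul]
      simp only [Complex.norm_ofNat, Complex.norm_real, Complex.norm_I, mul_one, Real.norm_eq_abs,
        abs_of_pos Real.pi_pos]
      gcongr
  · have h0 : HasDerivAt (fun z : ℂ => -(2 * Real.pi * Complex.I * q * z))
        (-(2 * Real.pi * Complex.I * q)) z := by
      have h := (hasDerivAt_id' z).const_mul (-(2 * Real.pi * Complex.I * q : ℂ))
      rw [mul_one] at h
      exact h.congr_of_eventuallyEq (Filter.Eventually.of_forall fun q => by ring)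
    exact (h0.cexp.mul_const (G q)).congr_deriv (by ring)

/-- Every `f ∈ 𝒜` has an entire extension in the first variable. -/
theorem exists_entireExt {f : 𝓢(Plane, ℂ)} (hf : f ∈ algA) (b : ℝ) :
    (Differentiable ℂ fun z : ℂ => ∫ q : ℝ, Complex.exp (-(2 * Real.pi * Complex.I * q * z)) *
        fourier1 (𝓕⁻ f : 𝓢(Plane, ℂ)) b q) ∧
      ∀ t : ℝ, ∫ q : ℝ, Complex.exp (-(2 * Real.pi * Complex.I * q * (t : ℂ))) *
        fourier1 (𝓕⁻ f : 𝓢(Plane, ℂ)) b q = f !₂[t, b] := by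
  obtain ⟨R, hR, hv⟩ := exists_bound_of_mem (mem_algA_iff.mp hf)
  refine ⟨differentiable_laplace (continuous_fourier1 _ _) hR
    (fun q hq => fourier1_eq_zero hv _ hq) (integrable_fourier1 (mem_algA_iff.mp hf) _),
    fun t => ?_⟩
  rw [← fourier_fourier1, Real.fourier_eq']
  congr 1; ext q
  rw [smul_eq_mul]
  congr 2
  simp
  ring

/-- For `f ∈ 𝒜` the function `entireExt f b` is the entire extension of `x₀ ↦ f (x₀, b)`. -/
theorem entireExt_spec {f : 𝓢(Plane, ℂ)} (hf : f ∈ algA) (b : ℝ) :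
    Differentiable ℂ (entireExt f b) ∧ ∀ t : ℝ, entireExt f b t = f !₂[t, b] := by
  obtain ⟨h1, h2⟩ := exists_entireExt hf b
  rw [entireExt_eq h1 h2]
  exact ⟨h1, h2⟩

/-- `f (x₀ + i lam, x₁)` is again in `𝒜`; in Fourier space the map is multiplication by an
exponential. -/
theorem exists_imShift (lam : ℝ) {f : 𝓢(Plane, ℂ)} (hf : f ∈ algA) :
    ∃ g ∈ algA, (∀ x, g x = imShift lam f x) ∧
      ∀ p, (𝓕⁻ g : 𝓢(Plane, ℂ)) p =
        Complex.exp ((2 * Real.pi * lam : ℝ) * p 0) * (𝓕⁻ f : 𝓢(Plane, ℂ)) p := by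
  obtain ⟨ψ, hψ, H⟩ := exists_mul_exp (mem_algA_iff.mp hf) (2 * Real.pi * lam)
  have hinv : 𝓕⁻ (𝓕 ψ) = ψ := by simp
  refine ⟨𝓕 ψ, mem_algA_iff.mpr (by rwa [hinv]), fun x => ?_, fun p => by rw [hinv, H]⟩
  have hx : x = !₂[x 0, x 1] := by
    ext i; fin_cases i <;> rfl
  have hE : entireExt f (x 1) = fun z : ℂ => ∫ q : ℝ,
      Complex.exp (-(2 * Real.pi * Complex.I * q * z)) *
        fourier1 (𝓕⁻ f : 𝓢(Plane, ℂ)) (x 1) q :=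
    entireExt_eq (exists_entireExt hf _).1 (exists_entireExt hf _).2
  unfold imShift
  rw [hE]
  nth_rewrite 1 [hx]
  rw [← fourier_fourier1, hinv, Real.fourier_eq']
  congr 1; ext q
  have hq : fourier1 ψ (x 1) q = Complex.exp ((2 * Real.pi * lam : ℝ) * q) *
      fourier1 (𝓕⁻ f : 𝓢(Plane, ℂ)) (x 1) q := by
    unfold fourier1
    rw [← integral_const_mul]
    congr 1; ext r
    rw [H]
    simp only [Matrix.cons_val_zero]
    ring
  rw [hq, smul_eq_mul, ← mul_assoc, ← Complex.exp_add]
  congr 2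
  simp only [RCLike.inner_apply, conj_trivial]
  push_cast
  linear_combination (2 * Real.pi * q * lam : ℂ) * Complex.I_sq

/-- The Schwartz function `x ↦ f (x₀ + i lam, x₁)`, for `f ∈ 𝒜`. -/
def imShiftSchwartz (lam : ℝ) (f : algA) : 𝓢(Plane, ℂ) where
  toFun := imShift lam (f : 𝓢(Plane, ℂ))
  smooth' := by
    obtain ⟨g, -, hg, -⟩ := exists_imShift lam f.2
    rw [← funext hg]
    exact g.smooth'
  decay' := by
    obtain ⟨g, -, hg, -⟩ := exists_imShift lam f.2
    rw [← funext hg]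
    exact g.decay'

theorem imShiftSchwartz_spec (lam : ℝ) (f : algA) :
    imShiftSchwartz lam f ∈ algA ∧ ∀ p, (𝓕⁻ (imShiftSchwartz lam f) : 𝓢(Plane, ℂ)) p =
      Complex.exp ((2 * Real.pi * lam : ℝ) * p 0) * (𝓕⁻ (f : 𝓢(Plane, ℂ)) : 𝓢(Plane, ℂ)) p := by
  obtain ⟨g, h1, hg, h2⟩ := exists_imShift lam f.2
  have : imShiftSchwartz lam f = g := SchwartzMap.ext fun x => (hg x).symm
  rw [this]
  exact ⟨h1, h2⟩

theorem algA_ext {f g : algA} (h : ∀ p, (𝓕⁻ (f : 𝓢(Plane, ℂ)) : 𝓢(Plane, ℂ)) p =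
    (𝓕⁻ (g : 𝓢(Plane, ℂ)) : 𝓢(Plane, ℂ)) p) : f = g := by
  have h1 : (𝓕⁻ (f : 𝓢(Plane, ℂ)) : 𝓢(Plane, ℂ)) = 𝓕⁻ (g : 𝓢(Plane, ℂ)) := SchwartzMap.ext h
  have h2 := congrArg (fun φ : 𝓢(Plane, ℂ) => (𝓕 φ : 𝓢(Plane, ℂ))) h1
  simp only [FourierTransform.fourier_fourierInv_eq] at h2
  exact Subtype.ext h2

theorem fourierInv_coe_add (f g : algA) (p : Plane) :
    (𝓕⁻ ((f + g : algA) : 𝓢(Plane, ℂ)) : 𝓢(Plane, ℂ)) p =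
      (𝓕⁻ (f : 𝓢(Plane, ℂ)) : 𝓢(Plane, ℂ)) p + (𝓕⁻ (g : 𝓢(Plane, ℂ)) : 𝓢(Plane, ℂ)) p := by
  rw [Submodule.coe_add, FourierTransform.fourierInv_add, add_apply]

theorem fourierInv_coe_smul (c : ℂ) (f : algA) (p : Plane) :
    (𝓕⁻ ((c • f : algA) : 𝓢(Plane, ℂ)) : 𝓢(Plane, ℂ)) p =
      c * (𝓕⁻ (f : 𝓢(Plane, ℂ)) : 𝓢(Plane, ℂ)) p := by
  rw [Submodule.coe_smul, FourierTransform.fourierInv_smul, smul_apply, smul_eq_mul]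

/-- The action of `ℰ`: `(ℰ ▷ f)(x) = f (x₀ + i lam, x₁)`. -/
def actE (lam : ℝ) : Module.End ℂ algA where
  toFun f := ⟨imShiftSchwartz lam f, (imShiftSchwartz_spec lam f).1⟩
  map_add' f g := algA_ext fun p => by
    rw [fourierInv_coe_add]
    simp only
    rw [(imShiftSchwartz_spec lam _).2, (imShiftSchwartz_spec lam _).2,
      (imShiftSchwartz_spec lam _).2, fourierInv_coe_add, mul_add]
  map_smul' c f := algA_ext fun p => by
    rw [RingHom.id_apply, fourierInv_coe_smul]
    simp only
    rw [(imShiftSchwartz_spec lam _).2, (imShiftSchwartz_spec lam _).2, fourierInv_coe_smul]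
    ring

theorem actE_apply (lam : ℝ) (f : algA) (x : Plane) :
    ((actE lam f : algA) : 𝓢(Plane, ℂ)) x =
      entireExt (f : 𝓢(Plane, ℂ)) (x 1) (x 0 + Complex.I * lam) := rfl

theorem fourierInv_actE (lam : ℝ) (f : algA) (p : Plane) :
    (𝓕⁻ ((actE lam f : algA) : 𝓢(Plane, ℂ)) : 𝓢(Plane, ℂ)) p =
      Complex.exp ((2 * Real.pi * lam : ℝ) * p 0) * (𝓕⁻ (f : 𝓢(Plane, ℂ)) : 𝓢(Plane, ℂ)) p :=
  (imShiftSchwartz_spec lam f).2 p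

theorem fourierInv_deriv (μ : Fin 2) (f : 𝓢(Plane, ℂ)) (p : Plane) :
    (𝓕⁻ (-Complex.I • ∂_{(EuclideanSpace.single μ 1 : Plane)} f) : 𝓢(Plane, ℂ)) p =
      -(2 * Real.pi * p μ) * (𝓕⁻ f : 𝓢(Plane, ℂ)) p := by
  have ht : Function.HasTemperateGrowth
    (fun x : Plane => inner ℝ x (EuclideanSpace.single μ 1 : Plane)) := by fun_prop
  rw [FourierTransform.fourierInv_smul, SchwartzMap.fourierInv_lineDerivOp_eq,
    smul_apply, smul_apply, SchwartzMap.smulLeftCLM_apply_apply ht]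
  have : inner ℝ p (EuclideanSpace.single μ 1 : Plane) = p μ := by
    simp [EuclideanSpace.inner_single_right]
  rw [this, Complex.real_smul, smul_eq_mul, smul_eq_mul]
  linear_combination (2 * Real.pi * p μ * (𝓕⁻ f : 𝓢(Plane, ℂ)) p : ℂ) * Complex.I_sq

theorem deriv_mem_algA (μ : Fin 2) {f : 𝓢(Plane, ℂ)} (hf : f ∈ algA) :
    -Complex.I • ∂_{(EuclideanSpace.single μ 1 : Plane)} f ∈ algA := by
  rw [mem_algA_iff] at hf ⊢
  obtain ⟨R, hR, H⟩ := exists_bound_of_mem hf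
  exact mem_schwartzC_of R fun x hx => by rw [fourierInv_deriv, H x hx, mul_zero]

/-- The action of `P_μ`: `P_μ ▷ f = -i ∂_μ f`. -/
def actP (μ : Fin 2) : Module.End ℂ algA where
  toFun f := ⟨-Complex.I • ∂_{(EuclideanSpace.single μ 1 : Plane)} (f : 𝓢(Plane, ℂ)),
    deriv_mem_algA μ f.2⟩
  map_add' f g := algA_ext fun p => by
    rw [fourierInv_coe_add]
    simp only
    rw [fourierInv_deriv, fourierInv_deriv, fourierInv_deriv, fourierInv_coe_add, mul_add]
  map_smul' c f := algA_ext fun p => by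
    rw [RingHom.id_apply, fourierInv_coe_smul]
    simp only
    rw [fourierInv_deriv, fourierInv_deriv, fourierInv_coe_smul]
    ring

theorem actP_apply (μ : Fin 2) (f : algA) (x : Plane) :
    ((actP μ f : algA) : 𝓢(Plane, ℂ)) x = -Complex.I *
      fderiv ℝ (f : 𝓢(Plane, ℂ)) x (EuclideanSpace.single μ 1) := by
  change (-Complex.I • ∂_{(EuclideanSpace.single μ 1 : Plane)} (f : 𝓢(Plane, ℂ))) x = _
  rw [smul_apply, smul_eq_mul, SchwartzMap.lineDerivOp_apply_eq_fderiv]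

theorem fourierInv_actP (μ : Fin 2) (f : algA) (p : Plane) :
    (𝓕⁻ ((actP μ f : algA) : 𝓢(Plane, ℂ)) : 𝓢(Plane, ℂ)) p =
      -(2 * Real.pi * p μ) * (𝓕⁻ (f : 𝓢(Plane, ℂ)) : 𝓢(Plane, ℂ)) p :=
  fourierInv_deriv μ f p

theorem actE_mul_neg (lam : ℝ) : actE lam * actE (-lam) = 1 :=
  LinearMap.ext fun f => algA_ext fun p => by
    rw [Module.End.mul_apply, fourierInv_actE, fourierInv_actE, ← mul_assoc, ← Complex.exp_add]
    simp

/-- `ℰ` acts invertibly on `𝒜`. -/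
def actEUnit (lam : ℝ) : (Module.End ℂ algA)ˣ where
  val := actE lam
  inv := actE (-lam)
  val_inv := actE_mul_neg lam
  inv_val := by simpa using actE_mul_neg (-lam)

theorem commute_actP (μ ν : Fin 2) : Commute (actP μ) (actP ν) :=
  LinearMap.ext fun f => algA_ext fun p => by
    rw [Module.End.mul_apply, Module.End.mul_apply, fourierInv_actP, fourierInv_actP,
      fourierInv_actP, fourierInv_actP]
    ring

theorem commute_actP_actE (μ : Fin 2) (lam : ℝ) : Commute (actP μ) (actE lam) :=
  LinearMap.ext fun f => algA_ext fun p => by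
    rw [Module.End.mul_apply, Module.End.mul_apply, fourierInv_actP, fourierInv_actE,
      fourierInv_actE, fourierInv_actP]
    ring

/-! ### The extended momentum algebra -/

/-- The extended momentum algebra: the commutative algebra `ℂ[P₀, P₁, ℰ, ℰ⁻¹]`, that is, the span of
the monomials `P₀ ^ i * P₁ ^ j * ℰ ^ k` with `i j : ℕ` and `k : ℤ`. -/
abbrev ExtMom : Type := AddMonoidAlgebra ℂ (ℕ × ℕ × ℤ)

/-- The generators `P₀`, `P₁`. -/
def genP (μ : Fin 2) : ExtMom :=
  AddMonoidAlgebra.single (if μ = 0 then (1, 0, 0) else (0, 1, 0)) 1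

/-- The generator `ℰ`. -/
def genE : ExtMom := AddMonoidAlgebra.single (0, 0, 1) 1

/-- The inverse of the generator `ℰ`. -/
def genEInv : ExtMom := AddMonoidAlgebra.single (0, 0, -1) 1

theorem genE_mul_genEInv : genE * genEInv = 1 := by
  simp [genE, genEInv, AddMonoidAlgebra.single_mul_single, AddMonoidAlgebra.one_def]
  rfl

theorem single_eq_gen (i j : ℕ) (k : ℕ) (c : ℂ) :
    (AddMonoidAlgebra.single (i, j, (k : ℤ)) c : ExtMom) =
      c • (genP 0 ^ i * genP 1 ^ j * genE ^ k) := by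
  simp [genP, genE, AddMonoidAlgebra.single_pow, AddMonoidAlgebra.single_mul_single]

/-- The involution: antilinear, fixing the monomials, so that `P_μ^* = P_μ` and `ℰ^* = ℰ`. -/
instance : StarRing ExtMom where
  star a := AddMonoidAlgebra.mapRingHom (ℕ × ℕ × ℤ) (starRingEnd ℂ) a
  star_involutive a := by
    ext m; simp
  star_mul a b := by rw [map_mul, mul_comm]
  star_add a b := map_add _ a b

theorem star_single (m : ℕ × ℕ × ℤ) (c : ℂ) :
    star (AddMonoidAlgebra.single m c : ExtMom) = AddMonoidAlgebra.single m (conj c) := by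
  change AddMonoidAlgebra.mapRingHom (ℕ × ℕ × ℤ) (starRingEnd ℂ) _ = _
  simp

instance : StarModule ℂ ExtMom where
  star_smul c a := by
    change AddMonoidAlgebra.mapRingHom (ℕ × ℕ × ℤ) (starRingEnd ℂ) _ =
      _ • AddMonoidAlgebra.mapRingHom (ℕ × ℕ × ℤ) (starRingEnd ℂ) _
    ext m; simp

/-- The action of monomials on `𝒜`. -/
def actMonomial (lam : ℝ) : Multiplicative (ℕ × ℕ × ℤ) →* Module.End ℂ algA where
  toFun m := actP 0 ^ m.toAdd.1 * actP 1 ^ m.toAdd.2.1 *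
    ((actEUnit lam ^ m.toAdd.2.2 : (Module.End ℂ algA)ˣ) : Module.End ℂ algA)
  map_one' := by simp
  map_mul' a b := by
    have hPE : ∀ μ, ∀ k : ℤ, Commute (actP μ)
        ((actEUnit lam ^ k : (Module.End ℂ algA)ˣ) : Module.End ℂ algA) := fun μ k =>
      Commute.units_zpow_right (u := actEUnit lam) (commute_actP_actE μ lam) k
    simp only [toAdd_mul, Prod.fst_add, Prod.snd_add, pow_add, zpow_add, Units.val_mul]
    have c1 := (commute_actP 0 1).pow_pow b.toAdd.1 a.toAdd.2.1
    have c2 := (hPE 0 a.toAdd.2.2).pow_left b.toAdd.1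
    have c3 := (hPE 1 a.toAdd.2.2).pow_left b.toAdd.2.1
    have c12 := (c2.symm).eq
    simp only [mul_assoc]
    congr 1
    rw [← mul_assoc, c1.eq, mul_assoc]
    congr 1
    rw [← mul_assoc _ (actP 0 ^ b.toAdd.1), ← c2.eq, mul_assoc]
    congr 1
    rw [← mul_assoc, c3.eq, mul_assoc]

/-- The representation `h ↦ h ▷ ·` of the extended momentum algebra on `𝒜`. -/
def act (lam : ℝ) : ExtMom →ₐ[ℂ] Module.End ℂ algA :=
  AddMonoidAlgebra.lift ℂ (Module.End ℂ algA) (ℕ × ℕ × ℤ) (actMonomial lam)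

theorem act_genP (lam : ℝ) (μ : Fin 2) : act lam (genP μ) = actP μ := by
  unfold act genP
  rw [AddMonoidAlgebra.lift_single]
  fin_cases μ <;> simp [actMonomial]

theorem act_genE (lam : ℝ) : act lam genE = actE lam := by
  unfold act genE
  rw [AddMonoidAlgebra.lift_single]
  simp [actMonomial, actEUnit]

/-! ### Unbounded operators and representations on a Hilbert space -/

section Operators

variable {H : Type*} [NormedAddCommGroup H] [InnerProductSpace ℂ H] [CompleteSpace H]

/-- An endomorphism of a subspace `D` of `H`, as an operator in `H` with domain `D`. -/
def endOp {D : Submodule ℂ H} (T : Module.End ℂ D) : H →ₗ.[ℂ] H where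
  domain := D
  toFun := D.subtype ∘ₗ T

/-- `T` is essentially self-adjoint: densely defined, closable, with self-adjoint closure. -/
def IsEssentiallySelfAdjoint (T : H →ₗ.[ℂ] H) : Prop :=
  Dense (T.domain : Set H) ∧ T.IsClosable ∧ IsSelfAdjoint T.closure

/-- An unbounded `*`-representation of a `*`-algebra `B` on a dense subspace `D` of `H`. -/
def IsUnboundedStarRep {B : Type*} [Ring B] [StarRing B] [Algebra ℂ B] {D : Submodule ℂ H}
    (ρ : B →ₐ[ℂ] Module.End ℂ D) : Prop :=
  Dense (D : Set H) ∧ ∀ (b : B) (ψ φ : D),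
    inner ℂ (ρ b ψ : H) (φ : H) = inner ℂ (ψ : H) (ρ (star b) φ : H)

end Operators

/-- The representation `ρ` of the extended momentum algebra on `𝒜 ⊆ ℋ`, `ρ(h) ψ = h ▷ ψ`. -/
def rho (lam : ℝ) : ExtMom →ₐ[ℂ] Module.End ℂ (gnsDomain lam) :=
  ((algAEquivDomain lam).conjAlgEquiv ℂ).toAlgHom.comp (act lam)

theorem rho_apply (lam : ℝ) (h : ExtMom) (f : algA) :
    (rho lam h (algAEquivDomain lam f) : GNSHilbert lam) = toGNS lam (act lam h f) := by
  have : rho lam h (algAEquivDomain lam f) =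
      algAEquivDomain lam (act lam h ((algAEquivDomain lam).symm (algAEquivDomain lam f))) := rfl
  rw [this, LinearEquiv.symm_apply_apply]
  rfl

end KappaMinkowski

end

/-! Every generator is treated in two pictures. In the first, `gnsForm_eq` turns the GNS form into
an `L²` product: up to the factor `1 / (2π)`, `(f, g)` is the integral over `(y, p)` of `conj K_f *
K_g`, where `K_f = kern lam f`. By `kern_eq_fourier1`, `K_f(p, y)` is the partial Fourier transform
of the slice of `𝓕⁻ f` at `q₀ = p / (2π)`, evaluated at `exp (-lam p) y`. A real multiplier in `q₀`
on `𝓕⁻ f` therefore becomes a real multiplier in `p` on `K_f`: `P₀` acts as `-p`, `ℰ` as `exp (lam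
p)`, and both are symmetric. The operator `P₁` acts as `-i exp (lam p) ∂_y`; it is symmetric by
integration by parts in `y` at fixed `p`, where the exponential is a real constant
(`integral_kern_lineDeriv`).

In the second picture all three generators, `P₁` included, multiply `𝓕⁻ f` by a smooth real function
`m`, so `T ± i` is multiplication by the nowhere vanishing `m ± i`. Dividing by it keeps a Schwartz
function Schwartz and does not enlarge its support in `q₀`. Hence `T ± i` maps `𝒜` onto `𝒜`
(`exists_actP_add_smul`, `exists_actE_add_smul`).

A symmetric operator `T` on a dense domain `D` with `(T ± i) D = D` is essentially self-adjoint, by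
`IsSymmetricOn.isEssentiallySelfAdjoint`, which works with graphs: the adjoint graph is the closure
of the graph. For the `*`-representation, monomials in commuting symmetric operators are symmetric,
and antilinearity extends this to the whole algebra. -/

noncomputable section

namespace KappaMinkowski

/-! ### A criterion for essential self-adjointness -/

section Criterion

variable {H : Type*} [NormedAddCommGroup H] [InnerProductSpace ℂ H]

/-- An endomorphism of a subspace `D` which is symmetric with respect to the inner product. -/
def IsSymmetricOn {D : Submodule ℂ H} (T : Module.End ℂ D) : Prop :=
  ∀ u v : D, inner ℂ (T u : H) (v : H) = inner ℂ (u : H) (T v : H)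

theorem mem_graph_endOp {D : Submodule ℂ H} {T : Module.End ℂ D} {x : H × H} :
    x ∈ (endOp T).graph ↔ ∃ u : D, ((u : H), (T u : H)) = x := by
  rw [LinearPMap.mem_graph_iff']
  rfl

/-- Symmetry makes `⟨T u, u⟩` real, so the cross term of the expanded square vanishes. Consequently
`‖u‖ ≤ ‖(T - i) u‖`. -/
theorem IsSymmetricOn.norm_sq_sub {D : Submodule ℂ H} {T : Module.End ℂ D} (hT : IsSymmetricOn T)
    (u : D) : ‖(T u : H) - Complex.I • (u : H)‖ ^ 2 = ‖(T u : H)‖ ^ 2 + ‖(u : H)‖ ^ 2 := by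
  have h1 : (inner ℂ (T u : H) (u : H)).im = 0 := by
    rw [← Complex.conj_eq_iff_im, inner_conj_symm, hT]
  rw [@norm_sub_sq ℂ, inner_smul_right, norm_smul, Complex.norm_I, one_mul]
  simp [h1]

/-- A vector pair in the adjoint graph is controlled by `v + i y` if `T - i` is surjective. -/
theorem norm_le_of_mem_adjoint {D : Submodule ℂ H} {T : Module.End ℂ D} (hD : Dense (D : Set H))
    (hT : IsSymmetricOn T) (hm : ∀ d : D, ∃ u : D, T u - Complex.I • u = d) {y v : H}
    (h : ∀ u : D, inner ℂ (T u : H) y = inner ℂ (u : H) v) :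
    ‖y‖ ≤ ‖v + Complex.I • y‖ := by
  have key : ∀ d : H, ‖inner ℂ d y‖ ≤ ‖d‖ * ‖v + Complex.I • y‖ := by
    intro d
    refine hD.induction (P := fun d => ‖inner ℂ d y‖ ≤ ‖d‖ * ‖v + Complex.I • y‖) ?_ ?_ d
    · intro d hd
      obtain ⟨u, hu⟩ := hm ⟨d, hd⟩
      have hu' : (T u : H) - Complex.I • (u : H) = d := congrArg Subtype.val hu
      -- With `d = (T - i) u`, the `-i` becomes `+i` on leaving the antilinear first slot.
      have e : inner ℂ d y = inner ℂ (u : H) (v + Complex.I • y) := by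
        rw [← hu', inner_sub_left, inner_smul_left, h, inner_add_right, inner_smul_right]
        simp
      have hn := hT.norm_sq_sub u
      rw [hu'] at hn
      have hle : ‖(u : H)‖ ≤ ‖d‖ := by
        refine (sq_le_sq₀ (norm_nonneg _) (norm_nonneg _)).mp ?_
        nlinarith [sq_nonneg ‖(T u : H)‖]
      rw [e]
      exact (norm_inner_le_norm _ _).trans (by gcongr)
    · exact isClosed_le (by fun_prop) (by fun_prop)
  -- The bound now holds on all of `H` by density, so `d = y` is allowed although `y` need not lie
  -- in `D`.
  have h2 := key y
  rw [inner_self_eq_norm_sq_to_K] at h2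
  simp only [norm_pow, RCLike.norm_ofReal, abs_norm] at h2
  rcases (norm_nonneg y).eq_or_lt with h0 | h0
  · rw [← h0]; exact norm_nonneg _
  · rw [sq] at h2
    exact le_of_mul_le_mul_left h2 h0

/-- For a fixed pair `x`, the condition defining the adjoint is closed in the graph element, so it
passes to limits. -/
theorem adjoint_topologicalClosure (g : Submodule ℂ (H × H)) :
    g.topologicalClosure.adjoint = g.adjoint := by
  refine le_antisymm (fun x hx => ?_) fun x hx => ?_
  · rw [Submodule.mem_adjoint_iff] at hx ⊢
    exact fun a b hab => hx a b (g.le_topologicalClosure hab)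
  · rw [Submodule.mem_adjoint_iff] at hx ⊢
    intro a b hab
    have hc : IsClosed {z : H × H | inner ℂ z.2 x.1 - inner ℂ z.1 x.2 = 0} :=
      isClosed_eq (by fun_prop) continuous_const
    exact closure_minimal (fun z hz => hx z.1 z.2 hz) hc hab

/-- A symmetric operator `T` on a dense subspace which is mapped onto itself by `T + i` and `T - i`
has the closure of its graph as adjoint graph. -/
theorem IsSymmetricOn.adjoint_graph {D : Submodule ℂ H} {T : Module.End ℂ D}
    (hT : IsSymmetricOn T) (hD : Dense (D : Set H))
    (hp : ∀ d : D, ∃ u : D, T u + Complex.I • u = d)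
    (hm : ∀ d : D, ∃ u : D, T u - Complex.I • u = d) :
    (endOp T).graph.adjoint = (endOp T).graph.topologicalClosure := by
  refine le_antisymm (fun x hx => ?_) ?_
  · obtain ⟨x, w⟩ := x
    rw [Submodule.mem_adjoint_iff] at hx
    have hx' : ∀ u : D, inner ℂ (T u : H) x = inner ℂ (u : H) w := fun u =>
      sub_eq_zero.mp (hx u (T u) (mem_graph_endOp.mpr ⟨u, rfl⟩))
    change (x, w) ∈ closure ((endOp T).graph : Set (H × H))
    refine Metric.mem_closure_iff.mpr fun ε hε => ?_
    -- Approximate `w + i x` by `d = (T + i) u`. The graph point `(u, T u)` will be within `ε` of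
    -- `(x, w)`: the first coordinate costs one `ε / 2`, the second costs two.
    obtain ⟨d, hd, hdist⟩ := Metric.mem_closure_iff.mp (hD (w + Complex.I • x)) (ε / 2)
      (by positivity)
    obtain ⟨u, hu⟩ := hp ⟨d, hd⟩
    have hu' : (T u : H) + Complex.I • (u : H) = d := congrArg Subtype.val hu
    have e : (w - T u) + Complex.I • (x - u) = w + Complex.I • x - d := by
      rw [← hu', smul_sub]; abel
    -- By symmetry `(u, T u)` lies in the adjoint graph, hence so does the difference `(x - u, w - T
    -- u)`, and its combination `v + i y` is the small vector `w + i x - d`.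
    have h1 := norm_le_of_mem_adjoint hD hT hm (y := x - u) (v := w - T u) fun u' => by
      rw [inner_sub_right, inner_sub_right, hx', hT]
    rw [e] at h1
    rw [dist_eq_norm] at hdist
    have h2 : ‖w - T u‖ ≤ ‖w + Complex.I • x - d‖ + ‖x - u‖ := by
      have : w - T u = (w + Complex.I • x - d) - Complex.I • (x - u) := by rw [← e]; abel
      rw [this]
      refine (norm_sub_le _ _).trans ?_
      rw [norm_smul, Complex.norm_I, one_mul]
    refine ⟨(u, T u), mem_graph_endOp.mpr ⟨u, rfl⟩, ?_⟩
    rw [Prod.dist_eq, max_lt_iff, dist_eq_norm, dist_eq_norm]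
    exact ⟨by linarith, by linarith⟩
  -- Conversely, symmetry puts the graph inside the adjoint graph, which is closed as an
  -- intersection of closed conditions.
  · rw [← adjoint_topologicalClosure]
    refine (endOp T).graph.topologicalClosure_minimal ?_ ?_
    · intro x hx
      obtain ⟨u, rfl⟩ := mem_graph_endOp.mp hx
      rw [adjoint_topologicalClosure, Submodule.mem_adjoint_iff]
      intro a b hab
      obtain ⟨v, hv⟩ := mem_graph_endOp.mp hab
      obtain ⟨rfl, rfl⟩ := Prod.mk.inj hv
      exact sub_eq_zero.mpr (hT v u)
    · have : (((endOp T).graph.topologicalClosure.adjoint : Submodule ℂ (H × H)) : Set (H × H)) =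
          ⋂ z ∈ (endOp T).graph.topologicalClosure,
            {x : H × H | inner ℂ z.2 x.1 - inner ℂ z.1 x.2 = 0} := by
        ext x
        simp [Submodule.mem_adjoint_iff]
      rw [this]
      exact isClosed_biInter fun z _ => isClosed_eq (by fun_prop) continuous_const

/-- A symmetric operator `T` on a dense subspace which is mapped onto itself by `T + i` and `T - i`
is essentially self-adjoint. -/
theorem IsSymmetricOn.isEssentiallySelfAdjoint [CompleteSpace H] {D : Submodule ℂ H}
    {T : Module.End ℂ D} (hT : IsSymmetricOn T) (hD : Dense (D : Set H))
    (hp : ∀ d : D, ∃ u : D, T u + Complex.I • u = d)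
    (hm : ∀ d : D, ∃ u : D, T u - Complex.I • u = d) :
    IsEssentiallySelfAdjoint (endOp T) := by
  have hD' : Dense ((endOp T).domain : Set H) := hD
  have hg := hT.adjoint_graph hD hp hm
  -- The closure of the graph is the graph of an operator, namely of the adjoint.
  have hc : (endOp T).IsClosable :=
    ⟨(endOp T).adjoint, by rw [LinearPMap.adjoint_graph_eq_graph_adjoint hD', hg]⟩
  refine ⟨hD', hc, ?_⟩
  have hD2 : Dense ((endOp T).closure.domain : Set H) := hD'.mono (endOp T).le_closure.1
  rw [LinearPMap.isSelfAdjoint_def]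
  refine LinearPMap.eq_of_eq_graph ?_
  rw [LinearPMap.adjoint_graph_eq_graph_adjoint hD2, ← hc.graph_closure_eq_closure_graph,
    adjoint_topologicalClosure, hg]

end Criterion

/-! ### Symmetry of the generators with respect to the GNS form -/

/-- `kern lam f p y` sees only the slice of `𝓕⁻ f` at `q₀ = p / (2π)`, on which a multiplier
depending on `q₀` alone is constant. -/
theorem kern_of_fourierInv_mul (lam : ℝ) {f g : 𝓢(Plane, ℂ)} (hf : f ∈ algA) (hg : g ∈ algA)
    {m : ℝ → ℂ} (h : ∀ x : Plane, (𝓕⁻ g : 𝓢(Plane, ℂ)) x = m (x 0) * (𝓕⁻ f : 𝓢(Plane, ℂ)) x)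
    (p y : ℝ) : kern lam g p y = m (p / (2 * Real.pi)) * kern lam f p y := by
  rw [kern_eq_fourier1 lam hf, kern_eq_fourier1 lam hg]
  unfold fourier1
  rw [← integral_const_mul]
  congr 1; ext r
  rw [h]
  simp only [Matrix.cons_val_zero]
  ring

/-- The multiplier reaches the kernels as a real function of `p`, so it moves freely across the
conjugation in the `L²` product. This covers `P₀` and `ℰ` but not `P₁`, whose multiplier depends on
`q₁`. -/
theorem gnsForm_symm_of_fourierInv_mul (lam : ℝ) {T : Module.End ℂ algA} {m : ℝ → ℝ}
    (h : ∀ (f : algA) (x : Plane), (𝓕⁻ ((T f : algA) : 𝓢(Plane, ℂ)) : 𝓢(Plane, ℂ)) x =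
      (m (x 0) : ℂ) * (𝓕⁻ (f : 𝓢(Plane, ℂ)) : 𝓢(Plane, ℂ)) x) (f g : algA) :
    gnsForm lam (T f : 𝓢(Plane, ℂ)) (g : 𝓢(Plane, ℂ)) =
      gnsForm lam (f : 𝓢(Plane, ℂ)) (T g : 𝓢(Plane, ℂ)) := by
  rw [gnsForm_eq lam (T f).2, gnsForm_eq lam f.2]
  congr 2; ext z
  rw [kern_of_fourierInv_mul lam f.2 (T f).2 (m := fun s => (m s : ℂ)) (h f),
    kern_of_fourierInv_mul lam g.2 (T g).2 (m := fun s => (m s : ℂ)) (h g), map_mul,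
    Complex.conj_ofReal]
  ring

theorem gnsForm_actP_zero (lam : ℝ) (f g : algA) :
    gnsForm lam (actP 0 f : 𝓢(Plane, ℂ)) (g : 𝓢(Plane, ℂ)) =
      gnsForm lam (f : 𝓢(Plane, ℂ)) (actP 0 g : 𝓢(Plane, ℂ)) :=
  gnsForm_symm_of_fourierInv_mul lam (m := fun s => -(2 * Real.pi * s))
    (fun f x => by rw [fourierInv_actP]; push_cast; rfl) f g

theorem gnsForm_actE (lam mu : ℝ) (f g : algA) :
    gnsForm lam (actE mu f : 𝓢(Plane, ℂ)) (g : 𝓢(Plane, ℂ)) =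
      gnsForm lam (f : 𝓢(Plane, ℂ)) (actE mu g : 𝓢(Plane, ℂ)) :=
  gnsForm_symm_of_fourierInv_mul lam (m := fun s => Real.exp (2 * Real.pi * mu * s))
    (fun f x => by rw [fourierInv_actE]; push_cast; rfl) f g

/-- Differentiation under the integral; the exponential is the chain-rule factor of the dilation `y
↦ exp (-lam p) y`. -/
theorem hasDerivAt_kern_right (lam : ℝ) (f : 𝓢(Plane, ℂ)) (p y : ℝ) :
    HasDerivAt (fun y => kern lam f p y) ((Real.exp (-(lam * p)) : ℂ) *
      kern lam (∂_{(EuclideanSpace.single 1 1 : Plane)} f : 𝓢(Plane, ℂ)) p y) y := by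
  let e1 : Plane := EuclideanSpace.single 1 1
  -- Absorbing the factor, constant in `y`, into a Schwartz function makes `schwartz_bound` give a
  -- dominating function uniform in `y`.
  let g : 𝓢(Plane, ℂ) := ((Real.exp (-(lam * p)) : ℝ) : ℂ) • ∂_{e1} f
  have hga : ∀ x : Plane, g x = (Real.exp (-(lam * p)) : ℂ) * fderiv ℝ f x e1 := by
    intro x
    simp [g, SchwartzMap.lineDerivOp_apply_eq_fderiv]
  rw [← kern_smul]
  change HasDerivAt (fun y => kern lam f p y) (kern lam g p y) y
  obtain ⟨C, hC, H⟩ := schwartz_bound g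
  refine (hasDerivAt_integral_of_dominated_loc_of_deriv_le (𝕜 := ℝ) (μ := volume)
    (F := fun (y t : ℝ) => Complex.exp (Complex.I * p * t) * f !₂[t, Real.exp (-(lam * p)) * y])
    (F' := fun (y t : ℝ) => Complex.exp (Complex.I * p * t) * g !₂[t, Real.exp (-(lam * p)) * y])
    (x₀ := y) (s := Set.univ) (bound := fun t => C * (1 + t ^ 2)⁻¹) Filter.univ_mem
    (Filter.Eventually.of_forall fun y => (integrable_slice f p _).aestronglyMeasurable)
    (integrable_slice f p _) (integrable_slice g p _).aestronglyMeasurable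
    (ae_of_all _ fun t y _ => ?_) (integrable_inv_one_add_sq.const_mul C)
    (ae_of_all _ fun t y _ => ?_)).2
  · rw [norm_mul, norm_exp_I_mul, one_mul]
    refine (H t _).trans ?_
    gcongr
    refine mul_le_of_le_one_right (by positivity) (inv_le_one_of_one_le₀ ?_)
    nlinarith [sq_nonneg (Real.exp (-(lam * p)) * y)]
  · have d3 : HasDerivAt (fun y : ℝ => (!₂[t, Real.exp (-(lam * p)) * y] : Plane))
        ((Real.exp (-(lam * p))) • e1) y := by
      have e : (fun y : ℝ => (!₂[t, Real.exp (-(lam * p)) * y] : Plane)) =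
          fun y => !₂[t, 0] + (Real.exp (-(lam * p)) * y) • e1 := by
        ext q i
        fin_cases i <;> simp [e1]
      rw [e]
      refine HasDerivAt.const_add _ (HasDerivAt.smul_const ?_ e1)
      simpa using (hasDerivAt_id y).const_mul (Real.exp (-(lam * p)))
    have d4 := (f.differentiableAt
      (x := !₂[t, Real.exp (-(lam * p)) * y])).hasFDerivAt.comp_hasDerivAt y d3
    refine (d4.const_mul _).congr_deriv ?_
    rw [hga]
    simp

/-- One factor is merely bounded and the other supplies the quadratic decay in `y`. This
integrability is what removes the boundary terms in the integration by parts. -/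
theorem integrable_kern_line (lam : ℝ) (f g : 𝓢(Plane, ℂ)) (p : ℝ) :
    Integrable fun y => conj (kern lam f p y) * kern lam g p y := by
  obtain ⟨C, hC, HC⟩ := kern_bound lam f
  obtain ⟨D, hD, HD⟩ := kern_bound lam g
  have hc : ∀ h : 𝓢(Plane, ℂ), Continuous fun y => kern lam h p y := fun h =>
    (continuous_kern lam h).comp (by fun_prop : Continuous fun y : ℝ => (p, y))
  have hi : Integrable fun y : ℝ => C * D * (1 + (Real.exp (-(lam * p)) * y) ^ 2)⁻¹ :=
    (integrable_inv_one_add_sq.comp_mul_left' (Real.exp_pos _).ne').const_mul _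
  refine hi.mono' ((Complex.continuous_conj.comp (hc f)).mul (hc g)).aestronglyMeasurable
    (ae_of_all _ fun y => ?_)
  rw [norm_mul, RCLike.norm_conj, mul_assoc]
  refine mul_le_mul ((HC p y).trans ?_) (HD p y) (norm_nonneg _) hC.le
  refine mul_le_of_le_one_right hC.le (inv_le_one_of_one_le₀ ?_)
  nlinarith [sq_nonneg (Real.exp (-(lam * p)) * y)]

/-- Integration by parts in `y`. Both sides carry the same chain-rule factor `exp (-lam p)`, which
is real and nonzero and cancels. -/
theorem integral_kern_lineDeriv (lam : ℝ) (f g : 𝓢(Plane, ℂ)) (p : ℝ) :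
    ∫ y, conj (kern lam (∂_{(EuclideanSpace.single 1 1 : Plane)} f : 𝓢(Plane, ℂ)) p y) *
        kern lam g p y =
      -∫ y, conj (kern lam f p y) *
        kern lam (∂_{(EuclideanSpace.single 1 1 : Plane)} g : 𝓢(Plane, ℂ)) p y := by
  set f' : 𝓢(Plane, ℂ) := ∂_{(EuclideanSpace.single 1 1 : Plane)} f with hf'
  set g' : 𝓢(Plane, ℂ) := ∂_{(EuclideanSpace.single 1 1 : Plane)} g with hg'
  set c : ℂ := (Real.exp (-(lam * p)) : ℂ) with hc
  have hc0 : c ≠ 0 := Complex.ofReal_ne_zero.mpr (Real.exp_pos _).ne'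
  have e1 : ∀ y, conj (kern lam f p y) * (c * kern lam g' p y) =
      c * (conj (kern lam f p y) * kern lam g' p y) := fun y => by ring
  have e2 : ∀ y, c * conj (kern lam f' p y) * kern lam g p y =
      c * (conj (kern lam f' p y) * kern lam g p y) := fun y => by ring
  have key := integral_mul_deriv_eq_deriv_mul_of_integrable
    (u := fun y => conj (kern lam f p y)) (v := fun y => kern lam g p y)
    (u' := fun y => c * conj (kern lam f' p y)) (v' := fun y => c * kern lam g' p y)
    (fun y _ => (hasDerivAt_kern_right lam f p y).star.congr_deriv (by
      rw [Complex.star_def, map_mul, Complex.conj_ofReal]))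
    (fun y _ => hasDerivAt_kern_right lam g p y)
    (((integrable_kern_line lam f g' p).const_mul c).congr (ae_of_all _ fun y => (e1 y).symm))
    (((integrable_kern_line lam f' g p).const_mul c).congr (ae_of_all _ fun y => (e2 y).symm))
    (integrable_kern_line lam f g p)
  simp only [e1, e2, integral_const_mul] at key
  refine mul_left_cancel₀ hc0 ?_
  rw [mul_neg, key, neg_neg]

theorem gnsForm_actP_one (lam : ℝ) (f g : algA) :
    gnsForm lam (actP 1 f : 𝓢(Plane, ℂ)) (g : 𝓢(Plane, ℂ)) =
      gnsForm lam (f : 𝓢(Plane, ℂ)) (actP 1 g : 𝓢(Plane, ℂ)) := by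
  have e : ∀ h : algA, ((actP 1 h : algA) : 𝓢(Plane, ℂ)) =
    -Complex.I • ∂_{(EuclideanSpace.single 1 1 : Plane)} (h : 𝓢(Plane, ℂ)) := fun h => rfl
  rw [gnsForm_eq lam (actP 1 f).2, gnsForm_eq lam f.2, Measure.volume_eq_prod,
    -- The order of integration is chosen with `y` innermost, so that the integration by parts
    -- applies for each `p`. Its sign compensates the one from `conj (-i) = i`.
    integral_prod_symm _ (integrable_kern_kern lam (actP 1 f).2 g),
    integral_prod_symm _ (integrable_kern_kern lam f.2 (actP 1 g))]
  congr 2; ext p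
  simp only [e, kern_smul, map_mul, map_neg, Complex.conj_I, neg_neg, mul_assoc,
    integral_const_mul, mul_left_comm _ (-Complex.I), integral_kern_lineDeriv]
  ring

theorem gnsForm_actP (lam : ℝ) (μ : Fin 2) (f g : algA) :
    gnsForm lam (actP μ f : 𝓢(Plane, ℂ)) (g : 𝓢(Plane, ℂ)) =
      gnsForm lam (f : 𝓢(Plane, ℂ)) (actP μ g : 𝓢(Plane, ℂ)) := by
  fin_cases μ
  · exact gnsForm_actP_zero lam f g
  · exact gnsForm_actP_one lam f g

/-! ### Resolvents of the generators on `𝒜` -/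

/-- Multiplication by a function of temperate growth preserves Schwartz functions and cannot enlarge
the support. The multiplier may depend on both variables, as the resolvent of `P₁` requires. -/
theorem exists_fourierInv_mul (g : algA) {m : Plane → ℂ} (hm : m.HasTemperateGrowth) :
    ∃ f : algA, ∀ p, (𝓕⁻ (f : 𝓢(Plane, ℂ)) : 𝓢(Plane, ℂ)) p =
      m p * (𝓕⁻ (g : 𝓢(Plane, ℂ)) : 𝓢(Plane, ℂ)) p := by
  obtain ⟨R, -, H⟩ := exists_bound_of_mem (mem_algA_iff.mp g.2)
  set ψ : 𝓢(Plane, ℂ) := SchwartzMap.smulLeftCLM ℂ m (𝓕⁻ (g : 𝓢(Plane, ℂ)) : 𝓢(Plane, ℂ))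
  have hψ : ∀ p, ψ p = m p * (𝓕⁻ (g : 𝓢(Plane, ℂ)) : 𝓢(Plane, ℂ)) p := fun p => by
    rw [SchwartzMap.smulLeftCLM_apply_apply hm, smul_eq_mul]
  have hinv : 𝓕⁻ (𝓕 ψ) = ψ := by simp
  refine ⟨⟨𝓕 ψ, mem_algA_iff.mpr ?_⟩, fun p => ?_⟩
  · rw [hinv]
    exact mem_schwartzC_of R fun x hx => by rw [hψ, H x hx, mul_zero]
  · rw [hinv, hψ]

/-- Since `σ² = -1`, rationalizing gives `1 / (c s + σ) = (c s - σ) / (1 + (c s)²)`, a product of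
two functions of temperate growth. -/
theorem hasTemperateGrowth_inv_mul_add_I {c : ℝ} {σ : ℂ} (hσ : σ = Complex.I ∨ σ = -Complex.I) :
    Function.HasTemperateGrowth fun s : ℝ => ((c * s : ℝ) + σ : ℂ)⁻¹ := by
  have h1 : Function.HasTemperateGrowth fun s : ℝ => (1 + ‖c * s‖ ^ 2) ^ (-1 : ℝ) :=
    (Function.hasTemperateGrowth_one_add_norm_sq_rpow ℝ (-1)).comp
      (ContinuousLinearMap.hasTemperateGrowth (c • ContinuousLinearMap.id ℝ ℝ))
  have h2 : Function.HasTemperateGrowth fun s : ℝ =>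
      (((1 + ‖c * s‖ ^ 2) ^ (-1 : ℝ) : ℝ) : ℂ) :=
    (ContinuousLinearMap.hasTemperateGrowth Complex.ofRealCLM).comp h1
  have h3 : Function.HasTemperateGrowth fun s : ℝ => ((c * s : ℝ) - σ : ℂ) :=
    (ContinuousLinearMap.hasTemperateGrowth
      (Complex.ofRealCLM.comp (c • ContinuousLinearMap.id ℝ ℝ))).sub
      (Function.HasTemperateGrowth.const σ)
  have hσ2 : σ ^ 2 = -1 := by rcases hσ with rfl | rfl <;> simp
  convert! h3.mul h2 using 1
  ext s
  have hne : ((1 + (c * s) ^ 2 : ℝ) : ℂ) ≠ 0 := Complex.ofReal_ne_zero.mpr (by positivity)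
  rw [Pi.mul_apply, Real.rpow_neg_one, Real.norm_eq_abs, sq_abs, Complex.ofReal_inv]
  refine inv_eq_of_mul_eq_one_right ?_
  rw [← mul_assoc, mul_inv_eq_one₀ hne]
  push_cast
  linear_combination -hσ2

theorem exists_actP_add_smul (μ : Fin 2) {σ : ℂ} (hσ : σ = Complex.I ∨ σ = -Complex.I)
    (g : algA) : ∃ f : algA, actP μ f + σ • f = g := by
  have hm : Function.HasTemperateGrowth fun x : Plane => ((-(2 * Real.pi) * x μ : ℝ) + σ : ℂ)⁻¹ :=
    (hasTemperateGrowth_inv_mul_add_I (c := -(2 * Real.pi)) hσ).comp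
      (ContinuousLinearMap.hasTemperateGrowth (EuclideanSpace.proj (𝕜 := ℝ) μ))
  obtain ⟨f, hf⟩ := exists_fourierInv_mul g hm
  refine ⟨f, algA_ext fun p => ?_⟩
  have hne : ((-(2 * Real.pi) * p μ : ℝ) + σ : ℂ) ≠ 0 := by
    intro h
    -- A real number plus `± i` has imaginary part `± 1`.
    have := congrArg Complex.im h
    rcases hσ with rfl | rfl <;> simp at this
  rw [fourierInv_coe_add, fourierInv_coe_smul, fourierInv_actP, hf, ← add_mul, ← mul_assoc]
  convert one_mul _ using 2
  rw [← mul_inv_cancel₀ hne]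
  push_cast
  ring

theorem exists_actE_add_smul (mu : ℝ) {σ : ℂ} (hσ : σ = Complex.I ∨ σ = -Complex.I)
    (g : algA) : ∃ f : algA, actE mu f + σ • f = g := by
  obtain ⟨R, hR, H⟩ := exists_bound_of_mem (mem_algA_iff.mp g.2)
  have hne : ∀ s : ℝ, (Complex.exp ((2 * Real.pi * mu : ℝ) * s) + σ : ℂ) ≠ 0 := by
    intro s h
    rw [← Complex.ofReal_mul, ← Complex.ofReal_exp] at h
    have := congrArg Complex.im h
    rw [Complex.add_im, Complex.ofReal_im] at this
    rcases hσ with rfl | rfl <;> simp at this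
  -- The cutoff equals `1` for `|q₀| ≤ R`, a region containing the support of `𝓕⁻ g`. It leaves the
  -- quotient unchanged and makes temperate growth of the multiplier automatic from compact support.
  let χ : ContDiffBump (0 : ℝ) := ⟨R, R + 1, hR, by linarith⟩
  let u : ℝ → ℂ := fun s => (χ s : ℂ) * (Complex.exp ((2 * Real.pi * mu : ℝ) * s) + σ)⁻¹
  have hu1 : HasCompactSupport u := by
    have : HasCompactSupport fun s => (χ s : ℂ) :=
      χ.hasCompactSupport.comp_left (g := Complex.ofReal) (by simp)
    exact this.mul_right
  have hu2 : ContDiff ℝ (⊤ : ℕ∞) u := by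
    have h1 : ContDiff ℝ (⊤ : ℕ∞) fun s => (χ s : ℂ) := Complex.ofRealCLM.contDiff.comp χ.contDiff
    have h2 : ContDiff ℝ (⊤ : ℕ∞) fun s : ℝ => ((2 * Real.pi * mu : ℝ) : ℂ) * (s : ℂ) :=
      contDiff_const.mul Complex.ofRealCLM.contDiff
    exact h1.mul ((h2.cexp.add contDiff_const).inv hne)
  have hm : Function.HasTemperateGrowth fun x : Plane => u (x 0) :=
    (hu1.hasTemperateGrowth hu2).comp
      (ContinuousLinearMap.hasTemperateGrowth (EuclideanSpace.proj (𝕜 := ℝ) (0 : Fin 2)))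
  obtain ⟨f, hf⟩ := exists_fourierInv_mul g hm
  refine ⟨f, algA_ext fun p => ?_⟩
  rw [fourierInv_coe_add, fourierInv_coe_smul, fourierInv_actE, hf, ← add_mul]
  by_cases hp : R < |p 0|
  · rw [H p hp]; simp
  · have hχ : χ (p 0) = 1 := χ.one_of_mem_closedBall (by simpa using hp)
    simp only [u, hχ, Complex.ofReal_one, one_mul]
    rw [← mul_assoc, mul_inv_cancel₀ (hne _), one_mul]

/-! ### The representation on the GNS space -/

theorem dense_gnsDomain (lam : ℝ) : Dense (gnsDomain lam : Set (GNSHilbert lam)) := by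
  have h : DenseRange (toGNS lam) :=
    UniformSpace.Completion.denseRange_coe.comp (toPreGNS lam).surjective.denseRange
      (UniformSpace.Completion.continuous_coe _)
  have e : (gnsDomain lam : Set (GNSHilbert lam)) = Set.range (toGNS lam) :=
    LinearMap.coe_range _
  rw [e]
  exact h

theorem isSymmetricOn_rho {lam : ℝ} {h : ExtMom} {T : Module.End ℂ algA} (hT : act lam h = T)
    (hs : ∀ f g : algA, gnsForm lam (T f : 𝓢(Plane, ℂ)) (g : 𝓢(Plane, ℂ)) =
      gnsForm lam (f : 𝓢(Plane, ℂ)) (T g : 𝓢(Plane, ℂ))) : IsSymmetricOn (rho lam h) := by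
  intro u v
  obtain ⟨f, rfl⟩ := (algAEquivDomain lam).surjective u
  obtain ⟨g, rfl⟩ := (algAEquivDomain lam).surjective v
  rw [rho_apply, rho_apply, hT]
  exact (inner_toGNS lam (T f) g).trans ((hs f g).trans (inner_toGNS lam f (T g)).symm)

theorem exists_rho_add_smul {lam : ℝ} {h : ExtMom} {T : Module.End ℂ algA} (hT : act lam h = T)
    {σ : ℂ} (hs : ∀ g : algA, ∃ f : algA, T f + σ • f = g) (d : gnsDomain lam) :
    ∃ u : gnsDomain lam, rho lam h u + σ • u = d := by
  obtain ⟨g, rfl⟩ := (algAEquivDomain lam).surjective d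
  obtain ⟨f, hf⟩ := hs g
  refine ⟨algAEquivDomain lam f, ?_⟩
  have e : rho lam h (algAEquivDomain lam f) = algAEquivDomain lam (T f) :=
    Subtype.ext ((rho_apply lam h f).trans (by rw [hT]; rfl))
  rw [e, ← map_smul, ← map_add, hf]

/-- Carries the criterion from `gnsDomain lam` back to `𝒜`, where symmetry is a statement about
`gnsForm` and the two range conditions are the cases `σ = ± i`. -/
theorem isEssentiallySelfAdjoint_rho {lam : ℝ} {h : ExtMom} {T : Module.End ℂ algA}
    (hT : act lam h = T)
    (hs : ∀ f g : algA, gnsForm lam (T f : 𝓢(Plane, ℂ)) (g : 𝓢(Plane, ℂ)) =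
      gnsForm lam (f : 𝓢(Plane, ℂ)) (T g : 𝓢(Plane, ℂ)))
    (hr : ∀ σ : ℂ, (σ = Complex.I ∨ σ = -Complex.I) →
      ∀ g : algA, ∃ f : algA, T f + σ • f = g) :
    IsEssentiallySelfAdjoint (endOp (rho lam h)) := by
  refine (isSymmetricOn_rho hT hs).isEssentiallySelfAdjoint (dense_gnsDomain lam)
    (exists_rho_add_smul hT (hr _ (Or.inl rfl))) fun d => ?_
  obtain ⟨u, hu⟩ := exists_rho_add_smul hT (hr _ (Or.inr rfl)) d
  exact ⟨u, by rw [← hu, neg_smul, sub_eq_add_neg]⟩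

/-! ### From the generators to the whole algebra: products of commuting symmetric operators -/

section Powers

variable {H : Type*} [NormedAddCommGroup H] [InnerProductSpace ℂ H] {D : Submodule ℂ H}

theorem IsSymmetricOn.mul {S T : Module.End ℂ D} (hS : IsSymmetricOn S) (hT : IsSymmetricOn T)
    (h : Commute S T) : IsSymmetricOn (S * T) := fun u v => by
  conv_rhs => rw [h.eq]
  rw [Module.End.mul_apply, Module.End.mul_apply, hS, hT]

theorem IsSymmetricOn.pow {T : Module.End ℂ D} (hT : IsSymmetricOn T) (n : ℕ) :
    IsSymmetricOn (T ^ n) := by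
  induction n with
  | zero => exact fun u v => rfl
  | succ n ih => exact ih.mul hT (Commute.pow_self T n)

end Powers

/-- The integer exponent `k` is split as `k.toNat - (-k).toNat`, so that only natural powers of `ℰ`
and of its inverse occur. -/
theorem single_eq_gen_mul (m : ℕ × ℕ × ℤ) : (AddMonoidAlgebra.single m 1 : ExtMom) =
    genP 0 ^ m.1 * genP 1 ^ m.2.1 * (genE ^ m.2.2.toNat * genEInv ^ (-m.2.2).toNat) := by
  obtain ⟨i, j, k⟩ := m
  simp only [genP, genE, genEInv, AddMonoidAlgebra.single_pow, AddMonoidAlgebra.single_mul_single]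
  have hk : (k.toNat : ℤ) + -((-k).toNat : ℤ) = k := by omega
  simpa using congrArg (fun l : ℤ => (AddMonoidAlgebra.single (i, j, l) 1 : ExtMom)) hk.symm

theorem isSymmetricOn_rho_genE (lam : ℝ) : IsSymmetricOn (rho lam genE) :=
  isSymmetricOn_rho (act_genE lam) (gnsForm_actE lam lam)

theorem isSymmetricOn_rho_genP (lam : ℝ) (μ : Fin 2) : IsSymmetricOn (rho lam (genP μ)) :=
  isSymmetricOn_rho (act_genP lam μ) (gnsForm_actP lam μ)

/-- The inverse of a symmetric bijection is symmetric: write each vector as `ℰ` applied to its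
preimage and move `ℰ` across. -/
theorem isSymmetricOn_rho_genEInv (lam : ℝ) : IsSymmetricOn (rho lam genEInv) := fun u v => by
  have h : ∀ w, rho lam genE (rho lam genEInv w) = w := fun w => by
    rw [← Module.End.mul_apply, ← map_mul, genE_mul_genEInv, map_one, Module.End.one_apply]
  conv_lhs => rw [← h v]
  conv_rhs => rw [← h u]
  rw [isSymmetricOn_rho_genE]

theorem isSymmetricOn_rho_single (lam : ℝ) (m : ℕ × ℕ × ℤ) :
    IsSymmetricOn (rho lam (AddMonoidAlgebra.single m 1)) := by
  rw [single_eq_gen_mul]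
  simp only [map_mul, map_pow]
  have hc : ∀ a b : ExtMom, Commute (rho lam a) (rho lam b) := fun a b =>
    (Commute.all a b).map (rho lam)
  refine IsSymmetricOn.mul (IsSymmetricOn.mul ((isSymmetricOn_rho_genP lam 0).pow _)
    ((isSymmetricOn_rho_genP lam 1).pow _) ((hc _ _).pow_pow _ _))
    (IsSymmetricOn.mul ((isSymmetricOn_rho_genE lam).pow _)
    ((isSymmetricOn_rho_genEInv lam).pow _) ((hc _ _).pow_pow _ _)) ?_
  simp only [← map_mul, ← map_pow]
  exact hc _ _

theorem isUnboundedStarRep_rho (lam : ℝ) : IsUnboundedStarRep (rho lam) := by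
  refine ⟨dense_gnsDomain lam, fun b => ?_⟩
  -- The involution fixes monomials, so there the claim is symmetry; scalars match because the star
  -- and the first slot of the inner product are both antilinear.
  induction b using AddMonoidAlgebra.induction_on with
  | of m =>
    intro ψ φ
    rw [AddMonoidAlgebra.of_apply, star_single, map_one]
    exact isSymmetricOn_rho_single lam _ ψ φ
  | add a b ha hb =>
    intro ψ φ
    simp only [star_add, map_add, LinearMap.add_apply, Submodule.coe_add, inner_add_left,
      inner_add_right, ha, hb]
  | smul c a ha =>
    intro ψ φ
    simp only [star_smul, map_smul, LinearMap.smul_apply, Submodule.coe_smul, inner_smul_left,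
      inner_smul_right, ha, starRingEnd_apply]

end KappaMinkowski

end

theorem mainTheorem8 (lam : ℝ) :
    (∀ μ : Fin 2, KappaMinkowski.IsEssentiallySelfAdjoint
      (KappaMinkowski.endOp (KappaMinkowski.rho lam (KappaMinkowski.genP μ)))) ∧
    KappaMinkowski.IsEssentiallySelfAdjoint
      (KappaMinkowski.endOp (KappaMinkowski.rho lam KappaMinkowski.genE)) ∧
    KappaMinkowski.IsUnboundedStarRep (KappaMinkowski.rho lam) :=
  ⟨fun μ => KappaMinkowski.isEssentiallySelfAdjoint_rho (KappaMinkowski.act_genP lam μ)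
      (KappaMinkowski.gnsForm_actP lam μ)
      fun _ hσ => KappaMinkowski.exists_actP_add_smul μ hσ,
    KappaMinkowski.isEssentiallySelfAdjoint_rho (KappaMinkowski.act_genE lam)
      (KappaMinkowski.gnsForm_actE lam lam)
      fun _ hσ => KappaMinkowski.exists_actE_add_smul lam hσ,
    KappaMinkowski.isUnboundedStarRep_rho lam⟩
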